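/- Work in the Grothendieck topos of sheaves of sets on a site $(C,J)$, and read all statements in its internal (Kripke–Joyal) logic: a "point" of a sheaf is a section at an arbitrary stage $c\in C$, "for all" ranges over all stages, and "there exists" means existence on a $J$-covering sieve. *Scalars.* Let $R$ be a sheaf of commutative $\mathbb Q$-algebras satisfying the Kock–Lawvere axiom: for every ideal $I\subseteq \mathbb Q[X_1,\dots,X_n]$ with $\mathfrak m^k\subseteq I\subseteq\mathfrak m=(X_1,\dots,X_n)$ for some $k$, every map $\{d\in R^n: p(d)=0\ \forall p\in I\}\to R$ is given by a polynomial with coefficients in $R$, unique modulo $I$. On $R^n$ put $p\sim q$ iff $(q_i-p_i)(q_j-p_j)=0$ for all $i,j$. *Manifolds.* Let $M$ be a sheaf with a reflexive symmetric relation $\sim$ (a subsheaf of $M\times M$). A subobject is *formally open* if it is closed under $\sim$. $M$ is a (formal) *manifold* if each point of $M$ locally lies in a formally open $U\subseteq M$ that has, for some $n$, an embedding $U\to R^n$ preserving and reflecting $\sim$ and with formally open image. An *$n$-path* from $a$ to $b$ is a sequence $a=x_0\sim x_1\sim\dots\sim x_n=b$; $M$ is *path connected* if any two points are joined by an $n$-path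 for some $n$ (internally: locally). *Connections.* An *affine connection* on $M$ is a partial ternary operation $[zxy]\in M$, defined for $x\sim y$ and $x\sim z$, with $[zxy]\sim y$, $[zxy]\sim z$, $[zxx]=z$, $[xxy]=y$ and $[[zxy]yx]=z$. It is *symmetric* if $[zxy]=[yxz]$, and *flat* if $[[axy]yz]=[axz]$ whenever $x,y,z$ are mutual neighbours and $a\sim x$. Two paths $(x,y_1,\dots,y_n)$, $(x,z_1,\dots,z_m)$ span the *grid* $u_{0,0}=x$, $u_{0,j}=y_j$, $u_{i,0}=z_i$, $u_{i+1,j+1}=[u_{i+1,j}\,u_{i,j}\,u_{i,j+1}]$, with codomain $u_{m,n}$. **Theorem.** Let $M$ be a path connected manifold with a symmetric flat affine connection. Then there is a unique everywhere defined operation $M\times M\times M\to M$, $(z,x,y)\mapsto[zxy]$, such that $[zxy]$ is the codomain of the grid spanned by any path from $x$ to $y$ and any path from $x$ to $z$; it extends the given connection. For each $o\in M$ the operation $x+_o y:=[xoy]$ makes $M$ an abelian group with unit $o$. For any other $o'\in M$, the map $z\mapsto[zoo']$ is a bijection and a group isomorphism from $(M,+_o)$ to $(M,+_{o'})$. -/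

import Mathlib

open CategoryTheory Opposite

universe w r v u

namespace Synthetic

/-! ## Scalars: a ring object satisfying the Kock-Lawvere axiom

Everything takes place in the Grothendieck topos of sheaves of sets on a site `(C, J)`.  Assertions
in the internal language of that topos are spelled out by Kripke-Joyal forcing: points of an object
`F` are sections `s` in `F(c)` at a stage `c`; "for all" ranges over all stages, "there exists" means
existence on a covering sieve. -/

section Line

variable {C : Type u} [Category.{v} C]

/-- Restriction of a scalar along a change of stage `f : d ⟶ c`. -/
def scalarRes (R : Cᵒᵖ ⥤ CommAlgCat.{r} ℚ) {c d : C} (f : d ⟶ c) :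
    R.obj (op c) →ₐ[ℚ] R.obj (op d) :=
  (R.map f.op).hom

/-- An ideal `I` of `ℚ[X₁,…,Xₙ]` presents a Weil algebra `ℚ[X₁,…,Xₙ]/I` if it is contained in the
ideal `𝔪 = (X₁,…,Xₙ)` and contains a power of it. -/
def IsWeilIdeal {n : ℕ} (I : Ideal (MvPolynomial (Fin n) ℚ)) : Prop :=
  I ≤ Ideal.span (Set.range MvPolynomial.X) ∧
    ∃ k : ℕ, Ideal.span (Set.range MvPolynomial.X) ^ k ≤ I

/-- The infinitesimal object `Spec_R (ℚ[X]/I)` at stage `c`: the `d ∈ R(c)ⁿ` at which all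
polynomials of `I` vanish. -/
def weilSpec (R : Cᵒᵖ ⥤ CommAlgCat.{r} ℚ) {n : ℕ} (I : Ideal (MvPolynomial (Fin n) ℚ)) (c : C) :
    Set (Fin n → R.obj (op c)) :=
  {d | ∀ p ∈ I, MvPolynomial.aeval d p = 0}

/-- The value at `d ∈ R(c')ⁿ` of a polynomial with coefficients in `R(c)`, for `g : c' ⟶ c`. -/
noncomputable def evalAt (R : Cᵒᵖ ⥤ CommAlgCat.{r} ℚ) {n : ℕ} {c c' : C} (g : c' ⟶ c)
    (P : MvPolynomial (Fin n) (R.obj (op c))) (d : Fin n → R.obj (op c')) : R.obj (op c') :=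
  MvPolynomial.eval₂ (scalarRes R g).toRingHom d P

/-- A map `Spec_R (ℚ[X]/I) → R` in the topos, defined over the stage `c`: a family of functions,
compatible with restriction, at all stages over `c`. -/
structure WeilMap (R : Cᵒᵖ ⥤ CommAlgCat.{r} ℚ) {n : ℕ} (I : Ideal (MvPolynomial (Fin n) ℚ))
    (c : C) where
  toFun : ∀ {c' : C}, (c' ⟶ c) → (Fin n → R.obj (op c')) → R.obj (op c')
  natural : ∀ {c' c'' : C} (g : c' ⟶ c) (h : c'' ⟶ c') (d : Fin n → R.obj (op c')),
    d ∈ weilSpec R I c' →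
      toFun (h ≫ g) (fun i => scalarRes R h (d i)) = scalarRes R h (toFun g d)

/-- A line object: a sheaf of commutative `ℚ`-algebras satisfying the general Kock-Lawvere axiom,
i.e. for each Weil algebra `W = ℚ[X]/I` the canonical map `R ⊗ W → R ^ (Spec_R W)` is an
isomorphism: each map `Spec_R W → R` is given by a polynomial, which is unique modulo `I`. -/
structure LineObject (J : GrothendieckTopology C) where
  ring : Cᵒᵖ ⥤ CommAlgCat.{r} ℚ
  isSheaf : Presheaf.IsSheaf J (ring ⋙ forget (CommAlgCat.{r} ℚ))
  kl_exists : ∀ {n : ℕ} (I : Ideal (MvPolynomial (Fin n) ℚ)), IsWeilIdeal I →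
    ∀ (c : C) (f : WeilMap ring I c), ∃ P : MvPolynomial (Fin n) (ring.obj (op c)),
      ∀ {c' : C} (g : c' ⟶ c), ∀ d ∈ weilSpec ring I c', f.toFun g d = evalAt ring g P d
  kl_unique : ∀ {n : ℕ} (I : Ideal (MvPolynomial (Fin n) ℚ)), IsWeilIdeal I →
    ∀ (c : C) (P : MvPolynomial (Fin n) (ring.obj (op c))),
      (∀ {c' : C} (g : c' ⟶ c), ∀ d ∈ weilSpec ring I c', evalAt ring g P d = 0) →
        P ∈ I.map (MvPolynomial.map (algebraMap ℚ (ring.obj (op c))))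

/-- The first order neighbour relation on `Rⁿ`: `p ∼ q` iff `q - p` lies in
`D(n) = {d ∣ dᵢ dⱼ = 0 for all i, j}`. -/
def CoordNear (R : Cᵒᵖ ⥤ CommAlgCat.{r} ℚ) {n : ℕ} {c : C} (p q : Fin n → R.obj (op c)) : Prop :=
  ∀ i j, (q i - p i) * (q j - p j) = 0

end Line

/-! ## Spaces with a neighbour relation and formal manifolds -/

section Spaces

variable {C : Type u} [Category.{v} C]

/-- A sheaf `M` (an object of the topos) with a reflexive symmetric relation `∼`,
i.e. a reflexive symmetric subobject `M₍₁₎` of `M × M`. -/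
structure NeighbourSpace (J : GrothendieckTopology C) where
  sheaf : Sheaf J (Type w)
  near : ∀ {c : C}, sheaf.obj.obj (op c) → sheaf.obj.obj (op c) → Prop
  near_refl : ∀ {c : C} (x : sheaf.obj.obj (op c)), near x x
  near_symm : ∀ {c : C} {x y : sheaf.obj.obj (op c)}, near x y → near y x
  near_res : ∀ {c d : C} (f : d ⟶ c) {x y : sheaf.obj.obj (op c)}, near x y →
    near (sheaf.obj.map f.op x) (sheaf.obj.map f.op y)
  near_local : ∀ {c : C} (S : Sieve c), S ∈ J c → ∀ x y : sheaf.obj.obj (op c),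
    (∀ {d : C} (f : d ⟶ c), S f → near (sheaf.obj.map f.op x) (sheaf.obj.map f.op y)) → near x y

variable {J : GrothendieckTopology C}

/-- The sections of `M` at stage `c`. -/
abbrev NeighbourSpace.Pt (M : NeighbourSpace.{w} J) (c : C) : Type w := M.sheaf.obj.obj (op c)

/-- Restriction of sections along a change of stage. -/
def NeighbourSpace.res (M : NeighbourSpace.{w} J) {c d : C} (f : d ⟶ c) (x : M.Pt c) : M.Pt d :=
  M.sheaf.obj.map f.op x

/-- A coordinate chart of `M` over the stage `c`: a subobject `U` of `M` (`domain`, a subsheaf over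
`c`) that is formally open (closed under `∼`), with an embedding `U → Rⁿ` (`coord`) that preserves
and reflects `∼` and whose image is formally open in `Rⁿ`. -/
structure Chart (R : LineObject.{r} J) (M : NeighbourSpace.{w} J) (c : C) where
  dim : ℕ
  domain : ∀ {d : C}, (d ⟶ c) → Set (M.Pt d)
  domain_res : ∀ {d e : C} (g : d ⟶ c) (h : e ⟶ d) {x : M.Pt d},
    x ∈ domain g → M.res h x ∈ domain (h ≫ g)
  domain_local : ∀ {d : C} (g : d ⟶ c) (S : Sieve d), S ∈ J d → ∀ x : M.Pt d,
    (∀ {e : C} (h : e ⟶ d), S h → M.res h x ∈ domain (h ≫ g)) → x ∈ domain g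
  domain_open : ∀ {d : C} (g : d ⟶ c) {x y : M.Pt d}, x ∈ domain g → M.near x y → y ∈ domain g
  coord : ∀ {d : C} (g : d ⟶ c), domain g → Fin dim → R.ring.obj (op d)
  coord_res : ∀ {d e : C} (g : d ⟶ c) (h : e ⟶ d) (x : domain g) (i : Fin dim),
    coord (h ≫ g) ⟨M.res h x.1, domain_res g h x.2⟩ i = scalarRes R.ring h (coord g x i)
  coord_injective : ∀ {d : C} (g : d ⟶ c), Function.Injective (coord g)
  coord_near : ∀ {d : C} (g : d ⟶ c) (x y : domain g),
    M.near x.1 y.1 ↔ CoordNear R.ring (coord g x) (coord g y)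
  coord_open : ∀ {d : C} (g : d ⟶ c) (x : domain g) (q : Fin dim → R.ring.obj (op d)),
    CoordNear R.ring (coord g x) q → ∃ y : domain g, coord g y = q

/-- `M` is a (formal) manifold: each point of `M` lies, locally, in the domain of a chart. -/
def IsManifold (R : LineObject.{r} J) (M : NeighbourSpace.{w} J) : Prop :=
  ∀ (c : C) (x : M.Pt c), ∃ S : Sieve c, S ∈ J c ∧ ∀ {d : C} (g : d ⟶ c), S g →
    ∃ φ : Chart R M d, M.res g x ∈ φ.domain (𝟙 d)

/-- `p 0, …, p n` is an `n`-path from `a` to `b` at stage `c`; later entries of `p` are ignored. -/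
def NeighbourSpace.IsPath (M : NeighbourSpace.{w} J) {c : C} (n : ℕ) (p : ℕ → M.Pt c)
    (a b : M.Pt c) : Prop :=
  p 0 = a ∧ p n = b ∧ ∀ i < n, M.near (p i) (p (i + 1))

/-- `M` is path connected: any two points are, locally, joined by an `n`-path for some `n`. -/
def NeighbourSpace.PathConnected (M : NeighbourSpace.{w} J) : Prop :=
  ∀ (c : C) (x y : M.Pt c), ∃ S : Sieve c, S ∈ J c ∧ ∀ {d : C} (g : d ⟶ c), S g →
    ∃ (n : ℕ) (p : ℕ → M.Pt d), M.IsPath n p (M.res g x) (M.res g y)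

/-! ## Affine connections and their extension -/

/-- An affine connection on `M`: a partial ternary operation `op z x y = [zxy]`, defined for `x ∼ y`
and `x ∼ z` (values of `op` elsewhere are irrelevant), which is a morphism in the topos and
satisfies the book-keeping, unit and inversion laws. -/
structure AffineConnection (M : NeighbourSpace.{w} J) where
  op : ∀ {c : C}, M.Pt c → M.Pt c → M.Pt c → M.Pt c
  op_res : ∀ {c d : C} (f : d ⟶ c) (z x y : M.Pt c), M.near x y → M.near x z →
    M.res f (op z x y) = op (M.res f z) (M.res f x) (M.res f y)
  near_right : ∀ {c : C} (z x y : M.Pt c), M.near x y → M.near x z → M.near (op z x y) y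
  near_left : ∀ {c : C} (z x y : M.Pt c), M.near x y → M.near x z → M.near (op z x y) z
  unit_left : ∀ {c : C} (z x : M.Pt c), M.near x z → op z x x = z
  unit_right : ∀ {c : C} (x y : M.Pt c), M.near x y → op x x y = y
  inversion : ∀ {c : C} (z x y : M.Pt c), M.near x y → M.near x z → op (op z x y) y x = z

/-- Symmetric (torsion free): `[zxy] = [yxz]`. -/
def AffineConnection.IsSymmetric {M : NeighbourSpace.{w} J} (L : AffineConnection M) : Prop :=
  ∀ {c : C} (z x y : M.Pt c), M.near x y → M.near x z → L.op z x y = L.op y x z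

/-- Flat (curvature free): for mutual neighbours `x`, `y`, `z`, transport from `x` to `y` followed
by transport from `y` to `z` is transport from `x` to `z`, on all neighbours `a` of `x`. -/
def AffineConnection.IsFlat {M : NeighbourSpace.{w} J} (L : AffineConnection M) : Prop :=
  ∀ {c : C} (x y z a : M.Pt c), M.near x y → M.near y z → M.near x z → M.near x a →
    L.op (L.op a x y) y z = L.op a x z

/-- The row of a grid above a given `row`, starting with `a`. -/
def gridStep {α : Type w} (op : α → α → α → α) (row : ℕ → α) (a : α) : ℕ → α
  | 0 => a
  | j + 1 => op (gridStep op row a j) (row j) (row (j + 1))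

/-- The grid `u` spanned by two paths `y`, `z` with common domain: `u 0 j = y j`, `u i 0 = z i` and
`u (i+1) (j+1) = [u (i+1) j, u i j, u i (j+1)]`. -/
def grid {α : Type w} (op : α → α → α → α) (y z : ℕ → α) : ℕ → ℕ → α
  | 0 => y
  | i + 1 => gridStep op (grid op y z i) (z (i + 1))

/-- An everywhere defined ternary operation on `M`, i.e. a morphism `M × M × M → M`. -/
structure TernaryOp (M : NeighbourSpace.{w} J) where
  op : ∀ {c : C}, M.Pt c → M.Pt c → M.Pt c → M.Pt c
  op_res : ∀ {c d : C} (f : d ⟶ c) (z x y : M.Pt c),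
    M.res f (op z x y) = op (M.res f z) (M.res f x) (M.res f y)

/-- `B` is the big operation of `L`: `[zxy]` is the codomain of the grid spanned by any path from
`x` to `y` and any path from `x` to `z`. -/
def TernaryOp.IsExtensionOf {M : NeighbourSpace.{w} J} (B : TernaryOp M)
    (L : AffineConnection M) : Prop :=
  ∀ {c : C} (x y z : M.Pt c) (n m : ℕ) (p q : ℕ → M.Pt c),
    M.IsPath n p x y → M.IsPath m q x z → B.op z x y = grid L.op p q m n

end Spaces

/-- `add` is the addition of an abelian group structure on `α` with unit `zero`. -/
def IsAbelianGroup {α : Type w} (add : α → α → α) (zero : α) : Prop :=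
  ∃ _ : AddCommGroup α, (∀ x y : α, x + y = add x y) ∧ (0 : α) = zero

end Synthetic

/-! The core is path independence: transporting a neighbour `a` of `x` along a path from `x` to `y`
(this is `gridStep`) gives a result that depends only on `x`, `y` and `a`. Charts are formally open,
so a path that starts in a chart never leaves it, and even long paths can be studied in one chart.
There a path is a list of displacements in D(n), and each coordinate of the transported point is a
function on D(n)ᵏ, hence multi-affine by Kock–Lawvere.

Flatness says directly only that two steps commute when their sum is again in D(n). The difference
between the two orders is an antisymmetric function on D(n)² that vanishes on such pairs and when a
step is zero. Its coefficients are therefore both symmetric and skew, so it is zero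
(`FirstOrderMap.eq_zero_of_antisymm`). Transport is thus a symmetric function of the displacements.
Over ℚ such a function depends only on their sum, because ∏(1 + ℓ(dᵢ)) = exp ℓ(∑ dᵢ)
(`FirstOrderMap.eq_of_sum_eq`), and the sum is the difference of the endpoints.

Applied row by row, path independence shows that the codomain of a grid does not change with the
horizontal path. Symmetry of the connection transposes grids and settles the vertical path
(`grid_eq_grid`). Codomains chosen locally then glue to a global operation. Pasting grids yields
[[zxy]yw] = [zxw]; the group laws follow formally from this, [zxx] = z and symmetry. -/

namespace Synthetic

/-- A vector is of first order if all products of its entries vanish, i.e. it lies in `D(n)`. -/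
def IsFirstOrder {A : Type*} [Mul A] [Zero A] {n : ℕ} (d : Fin n → A) : Prop :=
  ∀ i j, d i * d j = 0

/-! ### Polynomial algebra: first order vectors, the test ideal, symmetric multi-affine sums. -/

section Algebra

variable {A : Type*} [CommRing A] {n : ℕ}

theorem IsFirstOrder.zero : IsFirstOrder (0 : Fin n → A) := fun _ _ => by simp

theorem IsFirstOrder.map {B : Type*} [CommRing B] {F : Type*} [FunLike F A B] [RingHomClass F A B]
    {d : Fin n → A} (hd : IsFirstOrder d) (f : F) : IsFirstOrder (fun i => f (d i)) := fun i j => by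
  rw [← map_mul, hd i j, map_zero]

theorem eval₂_of_isFirstOrder {B : Type*} [CommRing B] (f : A →+* B) {d : Fin n → B}
    (hd : IsFirstOrder d) (P : MvPolynomial (Fin n) A) :
    P.eval₂ f d = f (P.coeff 0) + ∑ a, f (P.coeff (Finsupp.single a 1)) * d a := by
  classical
  induction P using MvPolynomial.induction_on with
  | C r => 
    simp [MvPolynomial.coeff_C, eq_comm (a := (0 : Fin n →₀ ℕ))]
  | add p q hp hq =>
    simp only [MvPolynomial.eval₂_add, hp, hq, MvPolynomial.coeff_add, map_add, add_mul,
      Finset.sum_add_distrib]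
    ring
  | mul_X p b hp =>
    have h1 : ∀ a, f (MvPolynomial.coeff (Finsupp.single a 1) (p * MvPolynomial.X b)) * d a
        = if a = b then f (p.coeff 0) * d a else 0 := fun a => by
      by_cases h : a = b
      · subst h; simp [MvPolynomial.coeff_mul_X']
      · simp [MvPolynomial.coeff_mul_X', h, Ne.symm h]
    rw [MvPolynomial.eval₂_mul, hp, MvPolynomial.eval₂_X, Finset.sum_congr rfl fun a _ => h1 a]
    simp [MvPolynomial.coeff_mul_X', add_mul, Finset.sum_mul, mul_assoc, hd _ b]

theorem isWeilIdeal_sq : IsWeilIdeal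
    (Ideal.span (Set.range (MvPolynomial.X : Fin n → MvPolynomial (Fin n) ℚ)) ^ 2) :=
  ⟨Ideal.pow_le_self two_ne_zero, 2, le_rfl⟩

/-- The ideal of the generic pair of vectors `(s, t)`, `(s', t')` of `D(2)` whose sum is in
`D(2)`; the variables are `s, t, s', t'` in this order. -/
noncomputable def sumPairIdeal : Ideal (MvPolynomial (Fin 4) ℚ) :=
  Ideal.span ({.X 0 * .X 0, .X 1 * .X 1, .X 0 * .X 1, .X 2 * .X 2, .X 3 * .X 3, .X 2 * .X 3,
    .X 0 * .X 2, .X 1 * .X 3, .X 0 * .X 3 + .X 1 * .X 2} ∪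
    Set.range fun i : Fin 4 × Fin 4 × Fin 4 => .X i.1 * .X i.2.1 * .X i.2.2)

theorem isWeilIdeal_sumPairIdeal : IsWeilIdeal sumPairIdeal := by
  have hX : ∀ i : Fin 4, MvPolynomial.X i ∈
      Ideal.span (Set.range (MvPolynomial.X : Fin 4 → MvPolynomial (Fin 4) ℚ)) :=
    fun i => Ideal.subset_span ⟨i, rfl⟩
  refine ⟨Ideal.span_le.2 ?_, 3, ?_⟩
  · rintro p (hp | ⟨i, rfl⟩)
    · simp only [Set.mem_insert_iff, Set.mem_singleton_iff] at hp
      rcases hp with rfl | rfl | rfl | rfl | rfl | rfl | rfl | rfl | rfl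
      case inr.inr.inr.inr.inr.inr.inr.inr =>
        exact add_mem (Ideal.mul_mem_left _ _ (hX _)) (Ideal.mul_mem_left _ _ (hX _))
      all_goals exact Ideal.mul_mem_left _ _ (hX _)
    · exact Ideal.mul_mem_left _ _ (hX _)
  · rw [pow_succ, sq, Ideal.span_mul_span', Ideal.span_mul_span', Ideal.span_le]
    rintro _ ⟨_, ⟨_, ⟨i, rfl⟩, _, ⟨j, rfl⟩, rfl⟩, _, ⟨k, rfl⟩, rfl⟩
    exact Ideal.subset_span (Or.inr ⟨(i, j, k), rfl⟩)

/-- In degree two, the only generator involving st' or ts' is st' + ts', in which both have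
coefficient 1; the cubic generators do not reach degree two. -/
theorem coeff_eq_of_mem_sumPairIdeal_map [Algebra ℚ A] {P : MvPolynomial (Fin 4) A}
    (hP : P ∈ sumPairIdeal.map (MvPolynomial.map (algebraMap ℚ A))) :
    P.coeff (Finsupp.single 0 1 + Finsupp.single 3 1) =
      P.coeff (Finsupp.single 1 1 + Finsupp.single 2 1) := by
  classical
  -- Quantifying over multipliers `q` makes the condition stable under the ideal operations, so it
  -- can be checked on generators.
  suffices h : ∀ q, (q * P).coeff (Finsupp.single 0 1 + Finsupp.single 3 1) =
      (q * P).coeff (Finsupp.single 1 1 + Finsupp.single 2 1) by simpa using h 1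
  rw [sumPairIdeal, Ideal.map_span] at hP
  induction hP using Submodule.span_induction with
  | zero => simp
  | add p q _ _ hp hq => simp [mul_add, hp, hq]
  | smul a p _ hp => intro q; simpa [mul_assoc] using hp (q * a)
  | mem p hp =>
    intro q
    obtain ⟨p, hp | ⟨⟨i, j, k⟩, rfl⟩, rfl⟩ := hp
    · simp only [Set.mem_insert_iff, Set.mem_singleton_iff] at hp
      rcases hp with rfl | rfl | rfl | rfl | rfl | rfl | rfl | rfl | rfl <;>
        simp [mul_add, ← mul_assoc, MvPolynomial.coeff_mul_X']
    · have key : ∀ m : Fin 4 →₀ ℕ, m.degree = 2 →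
          (q * (MvPolynomial.map (algebraMap ℚ A) (.X i * .X j * .X k))).coeff m = 0 := by
        intro m hm
        simp only [MvPolynomial.X, MvPolynomial.monomial_mul, MvPolynomial.map_monomial,
          MvPolynomial.coeff_mul_monomial']
        rw [if_neg]
        intro hle
        have := Finsupp.degree_mono hle
        simp [hm] at this
      rw [key _ (by simp), key _ (by simp)]

theorem exists_perm_of_card_fiber_eq {κ ι : Type*} [Fintype κ] [DecidableEq ι] {α β : κ → ι}
    (h : ∀ o, Fintype.card {i // α i = o} = Fintype.card {i // β i = o}) :
    ∃ σ : Equiv.Perm κ, α = β ∘ σ := by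
  refine ⟨(Equiv.sigmaFiberEquiv α).symm.trans ((Equiv.sigmaCongrRight fun o =>
    Fintype.equivOfCardEq (h o)).trans (Equiv.sigmaFiberEquiv β)), ?_⟩
  funext i
  exact ((Fintype.equivOfCardEq (h (α i))) ⟨i, rfl⟩).2.symm

/-- The vector `(1, d)`. -/
def affineExt (d : Fin n → A) (o : Option (Fin n)) : A := o.elim 1 d

/-- The exponents of the monomial `∏ X_{α i}`, where `X_none = 1`. -/
noncomputable def monomialOf {k : ℕ} (α : Fin k → Option (Fin n)) : Fin n →₀ ℕ :=
  ∑ i, (α i).elim 0 fun a => Finsupp.single a 1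

theorem monomialOf_apply {k : ℕ} (α : Fin k → Option (Fin n)) (a : Fin n) :
    monomialOf α a = Fintype.card {i // α i = some a} := by
  classical
  rw [monomialOf, Finsupp.finsetSum_apply, Fintype.card_subtype, Finset.card_filter]
  refine Finset.sum_congr rfl fun i _ => ?_
  rcases α i with _ | b
  · simp
  · simp [Finsupp.single_apply]

/-- The exponents count how often each `some a` is taken; the number of `none` is then forced, since
the total is `k`. -/
theorem exists_perm_of_monomialOf_eq {k : ℕ} {α β : Fin k → Option (Fin n)}
    (h : monomialOf α = monomialOf β) : ∃ σ : Equiv.Perm (Fin k), α = β ∘ σ := by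
  refine exists_perm_of_card_fiber_eq fun o => ?_
  have hs : ∀ a, Fintype.card {i // α i = some a} = Fintype.card {i // β i = some a} := fun a => by
    rw [← monomialOf_apply, ← monomialOf_apply, h]
  rcases o with _ | a
  · have hk : ∀ γ : Fin k → Option (Fin n), Fintype.card {i // γ i = none} +
        ∑ a, Fintype.card {i // γ i = some a} = k := fun γ => by
      rw [← Fintype.sum_option (fun o => Fintype.card {i // γ i = o}), ← Fintype.card_sigma,
        Fintype.card_congr (Equiv.sigmaFiberEquiv γ), Fintype.card_fin]
    have h1 := hk α
    have h2 := hk β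
    rw [Finset.sum_congr rfl fun a _ => hs a] at h1
    omega
  · exact hs a

/-- The linear form `∑ a, d a * X a`. -/
noncomputable def linearForm (d : Fin n → A) : MvPolynomial (Fin n) A :=
  ∑ a, MvPolynomial.C (d a) * MvPolynomial.X a

theorem linearForm_sq {d : Fin n → A} (hd : IsFirstOrder d) : linearForm d * linearForm d = 0 := by
  rw [linearForm, Finset.sum_mul_sum]
  refine Finset.sum_eq_zero fun a _ => Finset.sum_eq_zero fun b _ => ?_
  rw [mul_mul_mul_comm, ← map_mul, hd a b, map_zero, zero_mul]

/-- Each linear form squares to zero, so 1 + ℓ = exp ℓ, and exp turns sums of commuting nilpotents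
into products. The exponential needs rational scalars. -/
theorem prod_one_add_linearForm [Algebra ℚ A] {k : ℕ} {d : Fin k → Fin n → A}
    (hd : ∀ i, IsFirstOrder (d i)) :
    ∏ i, (1 + linearForm (d i)) = IsNilpotent.exp (linearForm (∑ i, d i)) := by
  have hlin : linearForm (∑ i, d i) = ∑ i, linearForm (d i) := by
    simp only [linearForm, Finset.sum_apply, map_sum, Finset.sum_mul]
    exact Finset.sum_comm
  rw [hlin]
  have hnil : ∀ i, IsNilpotent (linearForm (d i)) := fun i => ⟨2, by
    rw [sq, linearForm_sq (hd i)]⟩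
  have : ∀ s : Finset (Fin k), IsNilpotent (∑ i ∈ s, linearForm (d i)) ∧
      ∏ i ∈ s, (1 + linearForm (d i)) = IsNilpotent.exp (∑ i ∈ s, linearForm (d i)) := by
    intro s
    induction s using Finset.induction_on with
    | empty => simp
    | insert i s hi ih =>
      rw [Finset.sum_insert hi, Finset.prod_insert hi]
      refine ⟨(Commute.all _ _).isNilpotent_add (hnil i) ih.1, ?_⟩
      rw [IsNilpotent.exp_add_of_commute (Commute.all _ _) (hnil i) ih.1, ih.2]
      congr 1
      rw [IsNilpotent.exp_eq_sum (k := 2) (by rw [sq, linearForm_sq (hd i)])]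
      simp [Finset.sum_range_succ]
  exact (this Finset.univ).2

theorem prod_one_add_linearForm_eq_sum {k : ℕ} (d : Fin k → Fin n → A) :
    ∏ i, (1 + linearForm (d i)) =
      ∑ α : Fin k → Option (Fin n),
        MvPolynomial.monomial (monomialOf α) (∏ i, affineExt (d i) (α i)) := by
  have h : ∀ i, 1 + linearForm (d i) = ∑ o : Option (Fin n),
      MvPolynomial.monomial (o.elim 0 fun a => Finsupp.single a 1) (affineExt (d i) o) := fun i => by
    rw [Fintype.sum_option]
    simp [linearForm, affineExt, MvPolynomial.C_mul_X_eq_monomial]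
  simp only [h, Finset.prod_univ_sum, Fintype.piFinset_univ]
  refine Finset.sum_congr rfl fun α _ => ?_
  rw [monomialOf, MvPolynomial.monomial_sum_prod]

/-- A multi-affine function with symmetric coefficients depends, on first order vectors, only on
the sum of its arguments. -/
theorem sum_coef_eq_of_sum_eq [Algebra ℚ A] {k : ℕ} (coef : (Fin k → Option (Fin n)) → A)
    (hcoef : ∀ (σ : Equiv.Perm (Fin k)) α, coef (α ∘ σ) = coef α) {d d' : Fin k → Fin n → A}
    (hd : ∀ i, IsFirstOrder (d i)) (hd' : ∀ i, IsFirstOrder (d' i)) (h : ∑ i, d i = ∑ i, d' i) :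
    ∑ α, coef α * ∏ i, affineExt (d i) (α i) = ∑ α, coef α * ∏ i, affineExt (d' i) (α i) := by
  have hfac : coef.FactorsThrough monomialOf := fun α β hαβ => by
    obtain ⟨σ, rfl⟩ := exists_perm_of_monomialOf_eq hαβ
    exact hcoef σ β
  -- The linear functional sending each monomial to the common coefficient of all its index tuples
  -- (0 if there are none). It reads the whole sum off the product ∏(1 + ℓ(dᵢ)).
  let ℓ : MvPolynomial (Fin n) A →ₗ[A] A :=
    (MvPolynomial.basisMonomials (Fin n) A).constr A (Function.extend monomialOf coef 0)
  have hmon : ∀ m a, ℓ (MvPolynomial.monomial m a) = a * Function.extend monomialOf coef 0 m :=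
    fun m a => by
      rw [← mul_one a, ← smul_eq_mul a 1, ← MvPolynomial.smul_monomial, map_smul, smul_eq_mul,
        smul_eq_mul, mul_one]
      exact congrArg _ ((MvPolynomial.basisMonomials (Fin n) A).constr_basis A _ m)
  have hℓ : ∀ e : Fin k → Fin n → A,
      ∑ α, coef α * ∏ i, affineExt (e i) (α i) = ℓ (∏ i, (1 + linearForm (e i))) := fun e => by
    rw [prod_one_add_linearForm_eq_sum, map_sum]
    refine Finset.sum_congr rfl fun α _ => ?_
    rw [hmon, hfac.extend_apply, mul_comm]
  rw [hℓ, hℓ, prod_one_add_linearForm hd, prod_one_add_linearForm hd', h]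

end Algebra

/-! ### Consequences of the Kock–Lawvere axiom for functions on D(n)ᵏ. -/

section KockLawvere

variable {C : Type u} [Category.{v} C] {J : GrothendieckTopology C}

/-- The scalars at stage `c`. -/
abbrev LineObject.At (R : LineObject.{r} J) (c : C) : Type r := R.ring.obj (op c)

/-- Restriction of scalars. -/
abbrev LineObject.res (R : LineObject.{r} J) {c d : C} (f : d ⟶ c) : R.At c →ₐ[ℚ] R.At d :=
  scalarRes R.ring f

variable {R : LineObject.{r} J}

theorem LineObject.res_comp {c d e : C} (g : d ⟶ c) (h : e ⟶ d) (x : R.At c) :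
    R.res (h ≫ g) x = R.res h (R.res g x) := by
  simp [LineObject.res, scalarRes]

theorem LineObject.res_id {c : C} (x : R.At c) : R.res (𝟙 c) x = x := by
  simp [LineObject.res, scalarRes]

theorem mem_weilSpec_sq_iff {n : ℕ} {c : C} {d : Fin n → R.At c} :
    d ∈ weilSpec R.ring (Ideal.span (Set.range MvPolynomial.X) ^ 2) c ↔ IsFirstOrder d := by
  refine ⟨fun h i j => ?_, fun hd => ?_⟩
  · have := h (.X i * .X j) (by
      rw [sq]; exact Ideal.mul_mem_mul (Ideal.subset_span ⟨i, rfl⟩) (Ideal.subset_span ⟨j, rfl⟩))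
    simpa using this
  · suffices Ideal.span (Set.range MvPolynomial.X) ^ 2 ≤
        RingHom.ker (MvPolynomial.aeval d : MvPolynomial (Fin n) ℚ →ₐ[ℚ] R.At c) from
      fun p hp => this hp
    rw [sq, Ideal.span_mul_span', Ideal.span_le]
    rintro _ ⟨_, ⟨i, rfl⟩, _, ⟨j, rfl⟩, rfl⟩
    simpa [RingHom.mem_ker] using hd i j

/-- A function on `D(n)` is affine. -/
theorem exists_affine_expansion {n : ℕ} {c : C}
    (f : WeilMap R.ring (n := n) (Ideal.span (Set.range MvPolynomial.X) ^ 2) c) :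
    ∃ coef : Option (Fin n) → R.At c, ∀ {c' : C} (g : c' ⟶ c) (d : Fin n → R.At c'),
      IsFirstOrder d → f.toFun g d = ∑ o, R.res g (coef o) * affineExt d o := by
  obtain ⟨P, hP⟩ := R.kl_exists _ isWeilIdeal_sq c f
  refine ⟨fun o => P.coeff (o.elim 0 fun a => Finsupp.single a 1), fun g d hd => ?_⟩
  rw [hP g d (mem_weilSpec_sq_iff.2 hd), evalAt, eval₂_of_isFirstOrder _ hd, Fintype.sum_option]
  simp [affineExt]

/-- The coefficients of an affine function on `D(n)` are unique. -/
theorem affine_coef_eq_zero {n : ℕ} {c : C} (coef : Option (Fin n) → R.At c)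
    (h : ∀ {c' : C} (g : c' ⟶ c) (d : Fin n → R.At c'), IsFirstOrder d →
      ∑ o, R.res g (coef o) * affineExt d o = 0) : coef = 0 := by
  have h0 : coef none = 0 := by
    have := h (𝟙 c) 0 .zero
    simpa [Fintype.sum_option, affineExt, LineObject.res_id] using this
  -- A linear polynomial vanishing on D(n) lies in 𝔪², which has no terms of degree one.
  let P : MvPolynomial (Fin n) (R.At c) := ∑ a, MvPolynomial.C (coef (some a)) * .X a
  have hP := R.kl_unique _ isWeilIdeal_sq c P fun g d hd => by
    have := h g d (mem_weilSpec_sq_iff.1 hd)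
    rw [Fintype.sum_option, h0] at this
    simpa [evalAt, P, affineExt, MvPolynomial.eval₂_sum] using this
  rw [Ideal.map_pow, Ideal.map_span, ← Set.range_comp] at hP
  have hX : (⇑(MvPolynomial.map (σ := Fin n) (algebraMap ℚ (R.At c))) ∘ MvPolynomial.X) =
      MvPolynomial.X := by
    funext i; simp
  rw [hX] at hP
  have hc := (MvPolynomial.mem_pow_idealOfVars_iff' 2 P).1 hP
  funext o
  rcases o with _ | a
  · exact h0
  · have := hc (Finsupp.single a 1) (by simp)
    simpa [P, MvPolynomial.coeff_sum, MvPolynomial.coeff_C_mul, MvPolynomial.coeff_X,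
      Finsupp.single_left_inj (one_ne_zero (α := ℕ))] using this

theorem sum_fin_succ_arrow {ι A : Type*} [Fintype ι] [AddCommMonoid A] {k : ℕ}
    (f : (Fin (k + 1) → ι) → A) :
    ∑ α, f α = ∑ o, ∑ β : Fin k → ι, f (Fin.cons o β) := by
  rw [← (Fin.consEquiv fun _ => ι).sum_comp, Fintype.sum_prod_type]
  rfl

/-- A map `D(n)ᵏ → R` defined over the stage `c`. -/
structure FirstOrderMap (R : LineObject.{r} J) (k n : ℕ) (c : C) where
  toFun : ∀ {c' : C}, (c' ⟶ c) → (Fin k → Fin n → R.At c') → R.At c'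
  natural : ∀ {c' c'' : C} (g : c' ⟶ c) (h : c'' ⟶ c') (d : Fin k → Fin n → R.At c'),
    (∀ i, IsFirstOrder (d i)) →
      toFun (h ≫ g) (fun i a => R.res h (d i a)) = R.res h (toFun g d)

theorem affineExt_res {n : ℕ} {c c' : C} (h : c' ⟶ c) (d : Fin n → R.At c) (o : Option (Fin n)) :
    affineExt (fun a => R.res h (d a)) o = R.res h (affineExt d o) := by
  rcases o with _ | a <;> simp [affineExt]

/-- Coefficients of a multi-affine function on `D(n)ᵏ` are unique. -/
theorem multiaffine_coef_eq_zero {k n : ℕ} : ∀ {c : C} (coef : (Fin k → Option (Fin n)) → R.At c),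
    (∀ {c' : C} (g : c' ⟶ c) (d : Fin k → Fin n → R.At c'), (∀ i, IsFirstOrder (d i)) →
      ∑ α, R.res g (coef α) * ∏ i, affineExt (d i) (α i) = 0) → coef = 0 := by
  induction k with
  | zero =>
    intro c coef h
    have := h (𝟙 c) (fun i => i.elim0) (fun i => i.elim0)
    funext α
    rw [Fintype.sum_subsingleton _ α] at this
    simpa [LineObject.res_id] using this
  | succ k ih =>
    intro c coef h
    have key : ∀ o, (fun β : Fin k → Option (Fin n) => coef (Fin.cons o β)) = 0 := by
      intro o
      refine ih _ fun {c'} g d hd => ?_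
      -- With the last `k` arguments frozen, the sum is affine in the first one, and its
      -- coefficients are the sums to which the induction hypothesis applies.
      have := affine_coef_eq_zero (R := R) (c := c') (fun o =>
        ∑ β : Fin k → Option (Fin n), R.res g (coef (Fin.cons o β)) *
          ∏ i, affineExt (d i) (β i)) fun {c''} g' e he => by
        have := h (g' ≫ g) (Fin.cons e fun i a => R.res g' (d i a)) (fun i => by
          refine Fin.cases he (fun i => ?_) i
          exact (hd i).map (R.res g'))
        rw [sum_fin_succ_arrow] at this
        rw [← this]
        refine Finset.sum_congr rfl fun o _ => ?_
        rw [map_sum, Finset.sum_mul]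
        refine Finset.sum_congr rfl fun β _ => ?_
        simp [Fin.prod_univ_succ, LineObject.res_comp, affineExt_res]
        ring
      exact congrFun this o
    funext α
    rw [← Fin.cons_self_tail α]
    exact congrFun (key _) _

/-- A function on `D(n)ᵏ` is multi-affine. -/
theorem FirstOrderMap.exists_expansion {k n : ℕ} : ∀ {c : C} (F : FirstOrderMap R k n c),
    ∃ coef : (Fin k → Option (Fin n)) → R.At c, ∀ {c' : C} (g : c' ⟶ c)
      (d : Fin k → Fin n → R.At c'), (∀ i, IsFirstOrder (d i)) →
        F.toFun g d = ∑ α, R.res g (coef α) * ∏ i, affineExt (d i) (α i) := by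
  induction k with
  | zero =>
    intro c F
    refine ⟨fun _ => F.toFun (𝟙 c) (fun i => i.elim0), fun {c'} g d hd => ?_⟩
    have := F.natural (𝟙 c) g (fun i => i.elim0) (fun i => i.elim0)
    simp only [Category.comp_id] at this
    simp [← this, Subsingleton.elim d (fun i => i.elim0)]
    congr 1
    exact Subsingleton.elim _ _
  | succ k ih =>
    intro c F
    -- Freeze the last `k` arguments and expand in the first. The first order condition sits inside
    -- the existential so that `choose` yields functions of arbitrary `d`.
    have hex : ∀ {c' : C} (g : c' ⟶ c) (d : Fin k → Fin n → R.At c'),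
        ∃ f : Option (Fin n) → R.At c', (∀ i, IsFirstOrder (d i)) →
          ∀ {c'' : C} (h : c'' ⟶ c') (e : Fin n → R.At c''), IsFirstOrder e →
            F.toFun (h ≫ g) (Fin.cons e fun i a => R.res h (d i a)) =
              ∑ o, R.res h (f o) * affineExt e o := by
      intro c' g d
      by_cases hd : ∀ i, IsFirstOrder (d i)
      · obtain ⟨f, hf⟩ := exists_affine_expansion (R := R) (n := n) (c := c')
          { toFun := fun h e => F.toFun (h ≫ g) (Fin.cons e fun i a => R.res h (d i a))
            natural := fun {c₁ c₂} h h' e he => by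
              rw [mem_weilSpec_sq_iff] at he
              rw [← F.natural, Category.assoc]
              · congr 1
                funext i
                refine Fin.cases rfl (fun i => ?_) i
                funext a
                simp [LineObject.res_comp]
              · intro i
                refine Fin.cases he (fun i => ?_) i
                exact (hd i).map (R.res h) }
        exact ⟨f, fun _ _ => hf⟩
      · exact ⟨0, fun h => absurd h hd⟩
    choose f hf using @hex
    -- Uniqueness of affine coefficients makes the chosen ones compatible with restriction, so that
    -- they are again maps on D(n)ᵏ.
    have hnat : ∀ {c' c'' : C} (g : c' ⟶ c) (h : c'' ⟶ c') (d : Fin k → Fin n → R.At c'),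
        (∀ i, IsFirstOrder (d i)) → ∀ o,
          f (h ≫ g) (fun i a => R.res h (d i a)) o = R.res h (f g d o) := by
      intro c' c'' g h d hd o
      have := affine_coef_eq_zero (R := R) (fun o => f (h ≫ g) (fun i a => R.res h (d i a)) o
          - R.res h (f g d o)) fun {c₁} h' e he => by
        have h1 := hf (h ≫ g) (fun i a => R.res h (d i a)) (fun i => (hd i).map (R.res h)) h' e he
        have h2 := hf g d hd (h' ≫ h) e he
        simp only [LineObject.res_comp, Category.assoc] at h1 h2
        rw [h1] at h2
        simp only [map_sub, sub_mul, Finset.sum_sub_distrib]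
        exact sub_eq_zero.2 h2
      exact sub_eq_zero.1 (congrFun this o)
    choose coef hcoef using fun o => ih (c := c)
      { toFun := fun g d => f g d o
        natural := fun g h d hd => hnat g h d hd o }
    refine ⟨fun α => coef (α 0) (Fin.tail α), fun {c'} g d hd => ?_⟩
    have h1 := hf g (Fin.tail d) (fun i => hd _) (𝟙 _) (d 0) (hd 0)
    simp only [Category.id_comp, LineObject.res_id] at h1
    have h2 : (Fin.cons (d 0) fun i a => Fin.tail d i a) = d := Fin.cons_self_tail d
    rw [h2] at h1
    rw [h1, sum_fin_succ_arrow]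
    refine Finset.sum_congr rfl fun o _ => ?_
    have h3 := hcoef o g (Fin.tail d) fun i => hd _
    simp only at h3
    rw [h3, Finset.sum_mul]
    refine Finset.sum_congr rfl fun β _ => ?_
    simp [Fin.prod_univ_succ, Fin.tail]
    ring

/-- A symmetric function on `D(n)ᵏ` depends only on the sum of its arguments. -/
theorem FirstOrderMap.eq_of_sum_eq {k n : ℕ} {c : C} (F : FirstOrderMap R k n c)
    (hF : ∀ {c' : C} (g : c' ⟶ c) (d : Fin k → Fin n → R.At c') (σ : Equiv.Perm (Fin k)),
      (∀ i, IsFirstOrder (d i)) → F.toFun g (d ∘ σ) = F.toFun g d)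
    {d d' : Fin k → Fin n → R.At c} (hd : ∀ i, IsFirstOrder (d i)) (hd' : ∀ i, IsFirstOrder (d' i))
    (h : ∑ i, d i = ∑ i, d' i) : F.toFun (𝟙 c) d = F.toFun (𝟙 c) d' := by
  obtain ⟨coef, hcoef⟩ := F.exists_expansion
  rw [hcoef _ _ hd, hcoef _ _ hd']
  simp only [LineObject.res_id]
  refine sum_coef_eq_of_sum_eq coef (fun σ α => ?_) hd hd' h
  -- Permuting the arguments permutes the index tuples, so by uniqueness a symmetric function has
  -- symmetric coefficients.
  have := multiaffine_coef_eq_zero (R := R) (fun α => coef (α ∘ σ) - coef α) fun {c'} g e he => by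
    simp only [map_sub, sub_mul, Finset.sum_sub_distrib]
    rw [sub_eq_zero, ← hcoef g e he, ← hF g e σ he, hcoef g (e ∘ σ) fun i => he _,
      ← (Equiv.arrowCongr σ (Equiv.refl (Option (Fin n)))).sum_comp]
    refine Finset.sum_congr rfl fun β _ => ?_
    congr 1
    · congr 2
      funext i
      simp [Equiv.arrowCongr]
    · refine (Equiv.prod_comp σ _).symm.trans ?_
      simp [Equiv.arrowCongr]
  exact sub_eq_zero.1 (congrFun this α)

/-- An antisymmetric bilinear function on `D(n)²` which vanishes on all pairs with sum in `D(n)`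
vanishes. -/
theorem FirstOrderMap.eq_zero_of_antisymm {n : ℕ} {c : C} (F : FirstOrderMap R 2 n c)
    (hl : ∀ {c' : C} (g : c' ⟶ c) (e : Fin n → R.At c'), IsFirstOrder e → F.toFun g ![0, e] = 0)
    (hanti : ∀ {c' : C} (g : c' ⟶ c) (d e : Fin n → R.At c'), IsFirstOrder d → IsFirstOrder e →
      F.toFun g ![e, d] = - F.toFun g ![d, e])
    (hsum : ∀ {c' : C} (g : c' ⟶ c) (d e : Fin n → R.At c'), IsFirstOrder d → IsFirstOrder e →
      IsFirstOrder (d + e) → F.toFun g ![d, e] = 0)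
    {c' : C} (g : c' ⟶ c) (d e : Fin n → R.At c') (hd : IsFirstOrder d) (he : IsFirstOrder e) :
    F.toFun g ![d, e] = 0 := by
  obtain ⟨coef, hcoef⟩ := F.exists_expansion
  have hF : ∀ {c' : C} (g : c' ⟶ c) (d e : Fin n → R.At c'), IsFirstOrder d → IsFirstOrder e →
      F.toFun g ![d, e] = ∑ o, ∑ p, R.res g (coef ![o, p]) * (affineExt d o * affineExt e p) := by
    intro c' g d e hd he
    rw [hcoef g ![d, e] (Fin.forall_fin_two.2 ⟨hd, he⟩),
      ← (finTwoArrowEquiv (Option (Fin n))).symm.sum_comp, Fintype.sum_prod_type]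
    simp [finTwoArrowEquiv, Fin.prod_univ_two]
  have hnone : ∀ p, coef ![none, p] = 0 := by
    refine congrFun (affine_coef_eq_zero (R := R) (fun p => coef ![none, p]) fun g e he => ?_)
    rw [← hl g e he, hF g 0 e .zero he, Fintype.sum_option]
    simp [affineExt]
  have hskew : ∀ o p, coef ![o, p] = - coef ![p, o] := by
    intro o p
    have := multiaffine_coef_eq_zero (R := R) (k := 2)
        (fun α => coef ![α 0, α 1] + coef ![α 1, α 0]) fun {c'} g x hx => by
      have h1 := hanti g (x 1) (x 0) (hx 1) (hx 0)
      rw [hF g _ _ (hx 0) (hx 1), hF g _ _ (hx 1) (hx 0), eq_neg_iff_add_eq_zero] at h1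
      rw [← h1, Finset.sum_comm (γ := Option (Fin n)) (f := fun o p =>
        R.res g (coef ![o, p]) * (affineExt (x 1) o * affineExt (x 0) p)),
        ← (finTwoArrowEquiv (Option (Fin n))).symm.sum_comp, Fintype.sum_prod_type,
        ← Finset.sum_add_distrib]
      refine Finset.sum_congr rfl fun o _ => ?_
      rw [← Finset.sum_add_distrib]
      refine Finset.sum_congr rfl fun p _ => ?_
      simp [finTwoArrowEquiv, Fin.prod_univ_two]
      ring
    exact eq_neg_of_add_eq_zero_left (congrFun this ![o, p])
  have hbil : ∀ {c' : C} (g : c' ⟶ c) (d e : Fin n → R.At c'), IsFirstOrder d → IsFirstOrder e →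
      F.toFun g ![d, e] = ∑ a, ∑ b, R.res g (coef ![some a, some b]) * (d a * e b) := by
    intro c' g d e hd he
    have hnone' : ∀ o, coef ![o, none] = 0 := fun o => by rw [hskew, hnone, neg_zero]
    rw [hF g d e hd he, Fintype.sum_option]
    simp [Fintype.sum_option, hnone, hnone', affineExt]
  -- Test on d = s·eₐ + t·e_b and e = s'·eₐ + t'·e_b over `sumPairIdeal`, where d + e is of first
  -- order. There ss' = tt' = 0, so only the terms in st' and ts' survive.
  have hsym : ∀ a b, coef ![some a, some b] = coef ![some b, some a] := by
    intro a b
    have hP := R.kl_unique sumPairIdeal isWeilIdeal_sumPairIdeal c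
      (.C (coef ![some a, some b]) * (.X 0 * .X 3) + .C (coef ![some b, some a]) * (.X 1 * .X 2))
      fun {c'} g x hx => by
        have hgen : ∀ p, _ → MvPolynomial.aeval x p = 0 := fun p hp =>
          hx p (Ideal.subset_span (Or.inl hp))
        simp only [Set.mem_insert_iff, Set.mem_singleton_iff, forall_eq_or_imp, forall_eq, map_mul,
          map_add, MvPolynomial.aeval_X] at hgen
        obtain ⟨h00, h11, h01, h22, h33, h23, h02, h13, h0312⟩ := hgen
        have hpair : ∀ s t : R.At c', s * s = 0 → t * t = 0 → s * t = 0 →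
            IsFirstOrder (Pi.single a s + Pi.single b t : Fin n → R.At c') := by
          intro s t hs ht hst i j
          have hts : t * s = 0 := by rw [mul_comm, hst]
          simp only [Pi.add_apply, Pi.single_apply, add_mul, mul_add]
          split_ifs <;> simp [hs, ht, hst, hts]
        have hsum' : (Pi.single a (x 0) + Pi.single b (x 1) + (Pi.single a (x 2) +
            Pi.single b (x 3)) : Fin n → R.At c') =
            Pi.single a (x 0 + x 2) + Pi.single b (x 1 + x 3) := by
          rw [Pi.single_add, Pi.single_add]; abel
        have h := hsum g (Pi.single a (x 0) + Pi.single b (x 1))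
          (Pi.single a (x 2) + Pi.single b (x 3)) (hpair _ _ h00 h11 h01) (hpair _ _ h22 h33 h23)
          (hsum' ▸ hpair _ _ (by linear_combination h00 + h22 + 2 * h02)
            (by linear_combination h11 + h33 + 2 * h13)
            (by linear_combination h01 + h23 + h0312))
        rw [hbil g _ _ (hpair _ _ h00 h11 h01) (hpair _ _ h22 h33 h23)] at h
        simp only [Pi.add_apply, Pi.single_apply, add_mul, mul_add, ite_mul, mul_ite, mul_zero,
          zero_mul, Finset.sum_add_distrib, Finset.sum_ite_eq', Finset.mem_univ, if_true] at h
        simp only [evalAt, MvPolynomial.eval₂_add, MvPolynomial.eval₂_mul, MvPolynomial.eval₂_C,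
          MvPolynomial.eval₂_X]
        change _ + _ + (_ + _) = (0 : R.At c') at h
        change R.res g _ * _ + R.res g _ * _ = _
        linear_combination h - R.res g (coef ![some a, some a]) * h02 -
          R.res g (coef ![some b, some b]) * h13
    have hne : (Finsupp.single 1 1 + Finsupp.single 2 1 : Fin 4 →₀ ℕ) ≠
        Finsupp.single 0 1 + Finsupp.single 3 1 := fun h => by
      simpa using DFunLike.congr_fun h 0
    have := coeff_eq_of_mem_sumPairIdeal_map hP
    simpa [MvPolynomial.coeff_C_mul, MvPolynomial.X, MvPolynomial.monomial_mul,
      MvPolynomial.coeff_monomial, hne, hne.symm] using this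
  rw [hbil g d e hd he]
  have h0 : ∀ a b, coef ![some a, some b] = 0 := fun a b => by
    -- Symmetric and skew at once; 2 is invertible.
    have h2 : (2 : ℚ) • coef ![some a, some b] = 0 := by
      rw [two_smul]
      nth_rewrite 2 [hsym a b]
      rw [hskew (some a), neg_add_cancel]
    simpa using h2
  simp [h0]

end KockLawvere

/-! ### Transport inside one chart. -/

section Transport

variable {C : Type u} [Category.{v} C] {J : GrothendieckTopology C}

theorem NeighbourSpace.res_comp (M : NeighbourSpace.{w} J) {c d e : C} (g : d ⟶ c) (h : e ⟶ d)
    (x : M.Pt c) : M.res (h ≫ g) x = M.res h (M.res g x) := by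
  simp [NeighbourSpace.res]

theorem NeighbourSpace.res_id (M : NeighbourSpace.{w} J) {c : C} (x : M.Pt c) :
    M.res (𝟙 c) x = x := by
  simp [NeighbourSpace.res]

variable {R : LineObject.{r} J} {M : NeighbourSpace.{w} J} {c : C} (φ : Chart R M c)

open Classical in
/-- The coordinates of a point of the domain of a chart, `0` outside of the domain. -/
noncomputable def Chart.coords {d : C} (g : d ⟶ c) (x : M.Pt d) : Fin φ.dim → R.At d :=
  if h : x ∈ φ.domain g then φ.coord g ⟨x, h⟩ else 0

open Classical in
/-- The point of the domain of a chart whose coordinates differ from those of `x` by `v`. -/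
noncomputable def Chart.shift {d : C} (g : d ⟶ c) (x : M.Pt d) (v : Fin φ.dim → R.At d) : M.Pt d :=
  if h : ∃ y : φ.domain g, φ.coord g y = φ.coords g x + v then h.choose.1 else x

section

variable {φ} {d e : C} {g : d ⟶ c} {x y : M.Pt d} {v : Fin φ.dim → R.At d}

theorem Chart.coords_of_mem (hx : x ∈ φ.domain g) : φ.coords g x = φ.coord g ⟨x, hx⟩ :=
  dif_pos hx

theorem Chart.coords_res (h : e ⟶ d) (hx : x ∈ φ.domain g) :
    φ.coords (h ≫ g) (M.res h x) = fun i => R.res h (φ.coords g x i) := by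
  rw [coords_of_mem hx, coords_of_mem (φ.domain_res g h hx)]
  funext i
  exact φ.coord_res g h ⟨x, hx⟩ i

theorem Chart.eq_of_coords_eq (hx : x ∈ φ.domain g) (hy : y ∈ φ.domain g)
    (h : φ.coords g x = φ.coords g y) : x = y := by
  rw [coords_of_mem hx, coords_of_mem hy] at h
  exact congrArg Subtype.val (φ.coord_injective g h)

theorem Chart.near_iff (hx : x ∈ φ.domain g) (hy : y ∈ φ.domain g) :
    M.near x y ↔ IsFirstOrder (φ.coords g y - φ.coords g x) := by
  rw [coords_of_mem hx, coords_of_mem hy]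
  exact φ.coord_near g ⟨x, hx⟩ ⟨y, hy⟩

theorem Chart.shift_spec (hx : x ∈ φ.domain g) (hv : IsFirstOrder v) :
    φ.shift g x v ∈ φ.domain g ∧ φ.coords g (φ.shift g x v) = φ.coords g x + v := by
  have h : ∃ y : φ.domain g, φ.coord g y = φ.coords g x + v := by
    refine φ.coord_open g ⟨x, hx⟩ _ ?_
    rw [coords_of_mem hx]
    intro i j
    simpa using hv i j
  have hs : φ.shift g x v = h.choose.1 := dif_pos h
  rw [hs]
  refine ⟨h.choose.2, ?_⟩
  rw [coords_of_mem h.choose.2]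
  exact h.choose_spec

theorem Chart.near_shift (hx : x ∈ φ.domain g) (hv : IsFirstOrder v) :
    M.near x (φ.shift g x v) := by
  rw [near_iff hx (shift_spec hx hv).1, (shift_spec hx hv).2]
  simpa using hv

theorem Chart.shift_eq (hx : x ∈ φ.domain g) (hv : IsFirstOrder v) (hy : y ∈ φ.domain g)
    (h : φ.coords g y = φ.coords g x + v) : φ.shift g x v = y :=
  eq_of_coords_eq (shift_spec hx hv).1 hy ((shift_spec hx hv).2.trans h.symm)

/-- Although `shift` is defined by choice, its value is determined by its coordinates, and these are
natural. -/
theorem Chart.res_shift (h : e ⟶ d) (hx : x ∈ φ.domain g) (hv : IsFirstOrder v) :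
    M.res h (φ.shift g x v) = φ.shift (h ≫ g) (M.res h x) (fun i => R.res h (v i)) := by
  refine (shift_eq (φ.domain_res g h hx) (hv.map _) (φ.domain_res g h (shift_spec hx hv).1) ?_).symm
  rw [coords_res h (shift_spec hx hv).1, (shift_spec hx hv).2, coords_res h hx]
  funext i
  simp

end

variable (L : AffineConnection M)

/-- Move the foot `p.1` by `v` and transport `p.2` along. -/
noncomputable def Chart.step {d : C} (g : d ⟶ c) (v : Fin φ.dim → R.At d) (p : M.Pt d × M.Pt d) :
    M.Pt d × M.Pt d :=
  (φ.shift g p.1 v, L.op p.2 p.1 (φ.shift g p.1 v))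

/-- Pairs `x ∼ a` with `x` in the domain of the chart. -/
def Chart.Tangent {d : C} (g : d ⟶ c) (p : M.Pt d × M.Pt d) : Prop :=
  p.1 ∈ φ.domain g ∧ M.near p.1 p.2

variable {φ L} {d e : C} {g : d ⟶ c} {p : M.Pt d × M.Pt d} {v v' : Fin φ.dim → R.At d}

theorem Chart.Tangent.mem (hp : φ.Tangent g p) : p.2 ∈ φ.domain g := φ.domain_open g hp.1 hp.2

theorem Chart.Tangent.res (hp : φ.Tangent g p) (h : e ⟶ d) :
    φ.Tangent (h ≫ g) (p.map (M.res h) (M.res h)) :=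
  ⟨φ.domain_res g h hp.1, M.near_res h hp.2⟩

theorem Chart.Tangent.step (hp : φ.Tangent g p) (hv : IsFirstOrder v) :
    φ.Tangent g (φ.step L g v p) :=
  ⟨(shift_spec hp.1 hv).1, M.near_symm (L.near_right _ _ _ (near_shift hp.1 hv) hp.2)⟩

theorem Chart.Tangent.res_step (hp : φ.Tangent g p) (hv : IsFirstOrder v) (h : e ⟶ d) :
    (φ.step L g v p).map (M.res h) (M.res h) =
      φ.step L (h ≫ g) (fun i => R.res h (v i)) (p.map (M.res h) (M.res h)) := by
  simp only [Chart.step, Prod.map, L.op_res h _ _ _ (near_shift hp.1 hv) hp.2,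
    res_shift h hp.1 hv]

theorem Chart.Tangent.step_zero (hp : φ.Tangent g p) : φ.step L g 0 p = p := by
  have : φ.shift g p.1 0 = p.1 := shift_eq hp.1 .zero hp.1 (by simp)
  rw [Chart.step, this, L.unit_left _ _ hp.2]

theorem Chart.Tangent.fst_step_comm (hp : φ.Tangent g p) (hv : IsFirstOrder v)
    (hv' : IsFirstOrder v') :
    (φ.step L g v' (φ.step L g v p)).1 = (φ.step L g v (φ.step L g v' p)).1 := by
  have h := shift_spec hp.1 hv
  have h' := shift_spec hp.1 hv'
  refine shift_eq h.1 hv' (shift_spec h'.1 hv).1 ?_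
  simp only [Chart.step]
  rw [(shift_spec h'.1 hv).2, h.2, h'.2, add_right_comm]

/-- The condition on v + v' makes the three successive feet mutual neighbours, which is the case
covered by flatness. -/
theorem Chart.Tangent.snd_step_step (hflat : L.IsFlat) (hp : φ.Tangent g p) (hv : IsFirstOrder v)
    (hv' : IsFirstOrder v') (hvv' : IsFirstOrder (v + v')) :
    (φ.step L g v' (φ.step L g v p)).2 =
      L.op p.2 p.1 (φ.step L g v' (φ.step L g v p)).1 := by
  have h := shift_spec hp.1 hv
  have h' := shift_spec h.1 hv'
  refine hflat _ _ _ _ (near_shift hp.1 hv) (near_shift h.1 hv') ?_ hp.2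
  simp only [Chart.step]
  rw [near_iff hp.1 h'.1, h'.2, h.2, add_assoc, add_sub_cancel_left]
  exact hvv'

theorem Chart.Tangent.res_step_step (hp : φ.Tangent g p) (hv : IsFirstOrder v)
    (hv' : IsFirstOrder v') (h : e ⟶ d) :
    φ.coords (h ≫ g) (φ.step L (h ≫ g) (fun i => R.res h (v' i))
      (φ.step L (h ≫ g) (fun i => R.res h (v i)) (p.map (M.res h) (M.res h)))).2 =
      fun i => R.res h (φ.coords g (φ.step L g v' (φ.step L g v p)).2 i) := by
  rw [← coords_res h ((hp.step hv).step hv').mem, ← hp.res_step hv, ← (hp.step hv).res_step hv']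
  rfl

/-- Transport for a flat connection along two consecutive steps does not depend on their order. -/
theorem Chart.Tangent.step_comm (hflat : L.IsFlat) (hp : φ.Tangent g p) (hv : IsFirstOrder v)
    (hv' : IsFirstOrder v') :
    φ.step L g v' (φ.step L g v p) = φ.step L g v (φ.step L g v' p) := by
  refine Prod.ext (hp.fst_step_comm hv hv') ?_
  refine eq_of_coords_eq ((hp.step hv).step hv').mem ((hp.step hv').step hv).mem ?_
  funext i
  rw [← sub_eq_zero]
  let q {d' : C} (h : d' ⟶ d) (a b : Fin φ.dim → R.At d') :=
    (φ.step L (h ≫ g) b (φ.step L (h ≫ g) a (p.map (M.res h) (M.res h))))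
  have hq : ∀ {d' d'' : C} (h : d' ⟶ d) (h' : d'' ⟶ d') (a b : Fin φ.dim → R.At d'),
      IsFirstOrder a → IsFirstOrder b → φ.coords ((h' ≫ h) ≫ g)
        (q (h' ≫ h) (fun i => R.res h' (a i)) (fun i => R.res h' (b i))).2 i =
          R.res h' (φ.coords (h ≫ g) (q h a b).2 i) := by
    intro d' d'' h h' a b ha hb
    have := congrFun ((hp.res h).res_step_step (L := L) ha hb h') i
    simp only [Prod.map, ← M.res_comp, ← Category.assoc] at this
    exact this
  -- One coordinate of the difference between the two orders of stepping. It is antisymmetric by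
  -- construction and vanishes for v + v' in D(n) by flatness.
  have := FirstOrderMap.eq_zero_of_antisymm (R := R) (c := d) (n := φ.dim)
    { toFun := fun h D => φ.coords (h ≫ g) (q h (D 0) (D 1)).2 i
        - φ.coords (h ≫ g) (q h (D 1) (D 0)).2 i
      natural := fun h h' D hD => by
        rw [hq h h' _ _ (hD 0) (hD 1), hq h h' _ _ (hD 1) (hD 0), map_sub] }
    (fun h a ha => by
      simp [q, (hp.res h).step_zero, ((hp.res h).step ha).step_zero])
    (fun h a b ha hb => by simp)
    (fun h a b ha hb hab => by
      simp [q, (hp.res h).snd_step_step hflat ha hb hab,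
        (hp.res h).snd_step_step hflat hb ha (add_comm a b ▸ hab), (hp.res h).fst_step_comm ha hb])
    (𝟙 d) v v' hv hv'
  simpa [q, M.res_id, Prod.map] using this

theorem Chart.Tangent.foldr_step (hp : φ.Tangent g p) {l : List (Fin φ.dim → R.At d)}
    (hl : ∀ v ∈ l, IsFirstOrder v) : φ.Tangent g (l.foldr (φ.step L g) p) := by
  induction l with
  | nil => exact hp
  | cons v l ih => exact (ih fun v hv => hl v (.tail _ hv)).step (hl v (.head _))

theorem Chart.Tangent.res_foldr_step (hp : φ.Tangent g p) {l : List (Fin φ.dim → R.At d)}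
    (hl : ∀ v ∈ l, IsFirstOrder v) (h : e ⟶ d) :
    (l.foldr (φ.step L g) p).map (M.res h) (M.res h) =
      (l.map fun v i => R.res h (v i)).foldr (φ.step L (h ≫ g)) (p.map (M.res h) (M.res h)) := by
  induction l with
  | nil => rfl
  | cons v l ih =>
    have hl' : ∀ v ∈ l, IsFirstOrder v := fun v hv => hl v (.tail _ hv)
    rw [List.foldr_cons, (hp.foldr_step hl').res_step (hl v (.head _)), ih hl']
    rfl

theorem Chart.Tangent.foldr_step_perm (hflat : L.IsFlat) (hp : φ.Tangent g p)
    {l l' : List (Fin φ.dim → R.At d)} (hl : ∀ v ∈ l, IsFirstOrder v) (h : l.Perm l') :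
    l.foldr (φ.step L g) p = l'.foldr (φ.step L g) p := by
  induction h with
  | nil => rfl
  | cons v _ ih => rw [List.foldr_cons, ih fun v hv => hl v (.tail _ hv), List.foldr_cons]
  | swap v v' l =>
    exact (hp.foldr_step fun v hv => hl v (.tail _ (.tail _ hv))).step_comm hflat
      (hl v (by simp)) (hl v' (by simp))
  | trans h₁ _ ih₁ ih₂ => exact (ih₁ hl).trans (ih₂ fun v hv => hl v (h₁.mem_iff.2 hv))

/-- Transport for a flat connection along a sequence of steps depends only on their sum. -/
theorem Chart.Tangent.snd_foldr_step_eq (hflat : L.IsFlat) (hp : φ.Tangent g p)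
    {l l' : List (Fin φ.dim → R.At d)} (hl : ∀ v ∈ l, IsFirstOrder v)
    (hl' : ∀ v ∈ l', IsFirstOrder v) (hlen : l.length = l'.length) (hsum : l.sum = l'.sum) :
    (l.foldr (φ.step L g) p).2 = (l'.foldr (φ.step L g) p).2 := by
  obtain ⟨k, hk⟩ : ∃ k, l.length = k := ⟨_, rfl⟩
  have htuple : ∀ m : List (Fin φ.dim → R.At d), m.length = k →
      ∃ f : Fin k → Fin φ.dim → R.At d, List.ofFn f = m := by
    rintro m rfl
    exact ⟨m.get, List.ofFn_get m⟩
  obtain ⟨f, rfl⟩ := htuple l hk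
  obtain ⟨f', rfl⟩ := htuple l' (hlen ▸ hk)
  rw [List.sum_ofFn, List.sum_ofFn] at hsum
  rw [List.forall_mem_ofFn_iff] at hl hl'
  refine eq_of_coords_eq (hp.foldr_step (by rwa [List.forall_mem_ofFn_iff])).mem
    (hp.foldr_step (by rwa [List.forall_mem_ofFn_iff])).mem ?_
  funext i
  -- One coordinate of the transported point, as a function of all displacements; it is symmetric
  -- because steps commute.
  have := FirstOrderMap.eq_of_sum_eq (R := R) (c := d) (n := φ.dim) (k := k)
    { toFun := fun h D => φ.coords (h ≫ g) ((List.ofFn D).foldr (φ.step L (h ≫ g))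
        (p.map (M.res h) (M.res h))).2 i
      natural := fun {d' d''} h h' D hD => by
        have hD' : ∀ v ∈ List.ofFn D, IsFirstOrder v := by rwa [List.forall_mem_ofFn_iff]
        have h1 := congrArg Prod.snd ((hp.res h).res_foldr_step (L := L) hD' h')
        have h2 := congrFun (coords_res h' ((hp.res h).foldr_step (L := L) hD').mem) i
        rw [← h2]
        simp only [Prod.map_snd] at h1
        rw [h1]
        simp only [Prod.map, ← M.res_comp, List.map_ofFn, ← Category.assoc]
        rfl }
    (fun h D σ hD => by
      have hD' : ∀ v ∈ List.ofFn (D ∘ σ), IsFirstOrder v := by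
        rw [List.forall_mem_ofFn_iff]; exact fun i => hD _
      simp only [(hp.res h).foldr_step_perm hflat hD' (σ.ofFn_comp_perm D)])
    hl hl' hsum
  simpa [M.res_id, Prod.map] using this

/-- Displacements along a path, the last one first. -/
noncomputable def Chart.displacements (φ : Chart R M c) (g : d ⟶ c) (p : ℕ → M.Pt d) :
    ℕ → List (Fin φ.dim → R.At d)
  | 0 => []
  | n + 1 => (φ.coords g (p (n + 1)) - φ.coords g (p n)) :: φ.displacements g p n

theorem Chart.length_displacements (p : ℕ → M.Pt d) (n : ℕ) :
    (φ.displacements g p n).length = n := by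
  induction n with
  | zero => rfl
  | succ n ih => rw [displacements, List.length_cons, ih]

theorem Chart.sum_displacements (p : ℕ → M.Pt d) (n : ℕ) :
    (φ.displacements g p n).sum = φ.coords g (p n) - φ.coords g (p 0) := by
  induction n with
  | zero => simp [displacements]
  | succ n ih => rw [displacements, List.sum_cons, ih, sub_add_sub_cancel]

/-- Links paths with lists of steps: formal openness keeps the path in the chart, and each
displacement moves the foot to the next point of the path. -/
theorem Chart.foldr_displacements {p : ℕ → M.Pt d} {a : M.Pt d} (h0 : p 0 ∈ φ.domain g)
    {n : ℕ} (hp : ∀ i < n, M.near (p i) (p (i + 1))) :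
    p n ∈ φ.domain g ∧ (∀ v ∈ φ.displacements g p n, IsFirstOrder v) ∧
      (φ.displacements g p n).foldr (φ.step L g) (p 0, a) = (p n, gridStep L.op p a n) := by
  induction n with
  | zero => exact ⟨h0, by simp [displacements], rfl⟩
  | succ n ih =>
    obtain ⟨h1, h2, h3⟩ := ih fun i hi => hp i (by omega)
    have h4 := φ.domain_open g h1 (hp n (by omega))
    have h5 := (near_iff h1 h4).1 (hp n (by omega))
    refine ⟨h4, ?_, ?_⟩
    · rw [displacements]
      exact List.forall_mem_cons.2 ⟨h5, h2⟩
    · rw [displacements, List.foldr_cons, h3, step, shift_eq h1 h5 h4 (by simp)]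
      rfl

/-- In the domain of a chart, transport for a flat connection is path independent. -/
theorem Chart.gridStep_eq (hflat : L.IsFlat) {p q : ℕ → M.Pt d} {a : M.Pt d} {n : ℕ}
    (h0 : p 0 ∈ φ.domain g) (ha : M.near (p 0) a) (hp : ∀ i < n, M.near (p i) (p (i + 1)))
    (hq : ∀ i < n, M.near (q i) (q (i + 1))) (hpq0 : p 0 = q 0) (hpq : p n = q n) :
    gridStep L.op p a n = gridStep L.op q a n := by
  obtain ⟨-, h2, h3⟩ := foldr_displacements (L := L) (a := a) h0 hp
  obtain ⟨-, h2', h3'⟩ := foldr_displacements (L := L) (a := a) (hpq0 ▸ h0) hq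
  have := Tangent.snd_foldr_step_eq hflat (p := (p 0, a)) ⟨h0, ha⟩ h2 h2'
    (by rw [length_displacements, length_displacements])
    (by rw [sum_displacements, sum_displacements, hpq0, hpq])
  rw [h3, hpq0, h3'] at this
  exact this

end Transport

/-! ### Path independence of transport and of grid codomains; pasting of grids. -/

section Grid

variable {C : Type u} [Category.{v} C] {J : GrothendieckTopology C}
variable {R : LineObject.{r} J} {M : NeighbourSpace.{w} J}

theorem NeighbourSpace.eq_of_locally_eq (M : NeighbourSpace.{w} J) {c : C} {S : Sieve c}
    (hS : S ∈ J c) {x y : M.Pt c} (h : ∀ {d : C} (f : d ⟶ c), S f → M.res f x = M.res f y) :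
    x = y :=
  (((isSheaf_iff_isSheaf_of_type _ _).1 M.sheaf.property).isSeparated S hS).ext fun _ f hf => h f hf

theorem NeighbourSpace.IsPath.res {c d : C} (f : d ⟶ c) {n : ℕ} {p : ℕ → M.Pt c} {a b : M.Pt c}
    (h : M.IsPath n p a b) : M.IsPath n (fun i => M.res f (p i)) (M.res f a) (M.res f b) :=
  ⟨congrArg _ h.1, congrArg _ h.2.1, fun i hi => M.near_res f (h.2.2 i hi)⟩

variable {L : AffineConnection M} {c d : C}

theorem AffineConnection.near_gridStep (L : AffineConnection M) {p : ℕ → M.Pt c} {a : M.Pt c}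
    (ha : M.near (p 0) a) {n : ℕ} (hp : ∀ i < n, M.near (p i) (p (i + 1))) :
    M.near (p n) (gridStep L.op p a n) := by
  induction n with
  | zero => exact ha
  | succ n ih =>
    exact M.near_symm (L.near_right _ _ _ (hp n (by omega)) (ih fun i hi => hp i (by omega)))

theorem AffineConnection.near_gridStep_succ (L : AffineConnection M) {p : ℕ → M.Pt c} {a : M.Pt c}
    (ha : M.near (p 0) a) {n : ℕ} (hp : ∀ i < n, M.near (p i) (p (i + 1))) {i : ℕ} (hi : i < n) :
    M.near (gridStep L.op p a i) (gridStep L.op p a (i + 1)) :=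
  M.near_symm (L.near_left _ _ _ (hp i hi) (L.near_gridStep ha fun j hj => hp j (by omega)))

theorem AffineConnection.res_gridStep (f : d ⟶ c) {p : ℕ → M.Pt c} {a : M.Pt c}
    (ha : M.near (p 0) a) {n : ℕ} (hp : ∀ i < n, M.near (p i) (p (i + 1))) :
    M.res f (gridStep L.op p a n) = gridStep L.op (fun i => M.res f (p i)) (M.res f a) n := by
  induction n with
  | zero => rfl
  | succ n ih =>
    have hp' : ∀ i < n, M.near (p i) (p (i + 1)) := fun i hi => hp i (by omega)
    rw [gridStep, L.op_res f _ _ _ (hp n (by omega)) (L.near_gridStep ha hp'), ih hp']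
    rfl

theorem gridStep_congr {α : Type*} {op : α → α → α → α} {p q : ℕ → α} {a : α} {n : ℕ}
    (h : ∀ i ≤ n, p i = q i) : gridStep op p a n = gridStep op q a n := by
  induction n with
  | zero => rfl
  | succ n ih =>
    rw [gridStep, gridStep, ih fun i hi => h i (by omega), h n (by omega), h (n + 1) le_rfl]

/-- Waiting at the endpoint transports trivially, as [zxx] = z. This padding brings two paths to
equal length. -/
theorem AffineConnection.gridStep_min {p : ℕ → M.Pt c} {a : M.Pt c}
    (ha : M.near (p 0) a) {n : ℕ} (hp : ∀ i < n, M.near (p i) (p (i + 1))) (m : ℕ) :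
    gridStep L.op (fun i => p (min i n)) a (n + m) = gridStep L.op p a n := by
  induction m with
  | zero => exact gridStep_congr fun i hi => congrArg p (min_eq_left hi)
  | succ m ih =>
    rw [← add_assoc, gridStep, ih, min_eq_right (by omega), min_eq_right (by omega)]
    exact L.unit_left _ _ (L.near_gridStep ha hp)

theorem NeighbourSpace.IsPath.min {n : ℕ} {p : ℕ → M.Pt c} {a b : M.Pt c}
    (h : M.IsPath n p a b) (m : ℕ) : M.IsPath (n + m) (fun i => p (min i n)) a b := by
  refine ⟨by simpa using h.1, by simpa using h.2.1, fun i _ => ?_⟩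
  rcases lt_or_ge i n with hi | hi
  · simpa [min_eq_left hi.le, min_eq_left (Nat.succ_le_of_lt hi)] using h.2.2 i hi
  · simpa [min_eq_right hi, min_eq_right (hi.trans (Nat.le_succ i))] using M.near_refl _

/-- Equality of sections is local, and locally a chart around the starting point contains both paths
entirely. -/
theorem AffineConnection.IsFlat.gridStep_eq_of_length_eq (hM : IsManifold R M) (hflat : L.IsFlat)
    {x y a : M.Pt c} {n : ℕ} {p q : ℕ → M.Pt c} (hp : M.IsPath n p x y) (hq : M.IsPath n q x y)
    (ha : M.near x a) : gridStep L.op p a n = gridStep L.op q a n := by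
  obtain ⟨S, hS, hφ⟩ := hM c x
  refine M.eq_of_locally_eq hS fun {d} f hf => ?_
  obtain ⟨φ, hx⟩ := hφ f hf
  obtain ⟨rfl, rfl, hp⟩ := hp
  obtain ⟨h0, hn, hq⟩ := hq
  rw [res_gridStep f ha hp, res_gridStep f (h0 ▸ ha) hq]
  exact φ.gridStep_eq hflat (g := 𝟙 d) (p := fun i => M.res f (p i))
    (q := fun i => M.res f (q i)) hx (M.near_res f ha) (fun i hi => M.near_res f (hp i hi))
    (fun i hi => M.near_res f (hq i hi)) (congrArg (M.res f) h0.symm) (congrArg (M.res f) hn.symm)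

/-- On a manifold, transport for a flat connection is path independent. -/
theorem AffineConnection.IsFlat.gridStep_eq (hM : IsManifold R M) (hflat : L.IsFlat)
    {x y a : M.Pt c} {n m : ℕ} {p q : ℕ → M.Pt c} (hp : M.IsPath n p x y) (hq : M.IsPath m q x y)
    (ha : M.near x a) : gridStep L.op p a n = gridStep L.op q a m := by
  rw [← gridStep_min (hp.1 ▸ ha) hp.2.2 m, ← gridStep_min (hq.1 ▸ ha) hq.2.2 n, add_comm m n]
  exact hflat.gridStep_eq_of_length_eq hM (hp.min m) (add_comm m n ▸ hq.min n) ha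

section

variable {x y z w : M.Pt c} {n m n' m' : ℕ} {p q p' q' : ℕ → M.Pt c}

theorem grid_apply_zero {α : Type*} (op : α → α → α → α) {p q : ℕ → α} (h : p 0 = q 0) (i : ℕ) :
    grid op p q i 0 = q i := by
  cases i with
  | zero => exact h
  | succ i => rfl

/-- The rows of a grid are paths. -/
theorem NeighbourSpace.IsPath.grid_row (L : AffineConnection M) (hp : M.IsPath n p x y)
    (hq : M.IsPath m q x z) {i : ℕ} (hi : i ≤ m) :
    M.IsPath n (grid L.op p q i) (q i) (grid L.op p q i n) := by
  refine ⟨grid_apply_zero _ (hp.1.trans hq.1.symm) i, rfl, ?_⟩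
  induction i with
  | zero => exact hp.2.2
  | succ i ih =>
    refine fun j hj => L.near_gridStep_succ ?_ (ih (by omega)) hj
    rw [grid_apply_zero _ (hp.1.trans hq.1.symm)]
    exact hq.2.2 i hi

theorem NeighbourSpace.IsPath.near_grid_succ (L : AffineConnection M) (hp : M.IsPath n p x y)
    (hq : M.IsPath m q x z) {i j : ℕ} (hi : i < m) (hj : j ≤ n) :
    M.near (grid L.op p q i j) (grid L.op p q (i + 1) j) := by
  refine L.near_gridStep ?_ fun k hk => (hp.grid_row L hq hi.le).2.2 k (by omega)
  rw [grid_apply_zero _ (hp.1.trans hq.1.symm)]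
  exact hq.2.2 i hi

/-- The columns of a grid are paths. -/
theorem NeighbourSpace.IsPath.grid_col (L : AffineConnection M) (hp : M.IsPath n p x y)
    (hq : M.IsPath m q x z) {j : ℕ} (hj : j ≤ n) :
    M.IsPath m (fun i => grid L.op p q i j) (p j) (grid L.op p q m j) :=
  ⟨rfl, rfl, fun _ hi => hp.near_grid_succ L hq hi hj⟩

theorem AffineConnection.res_grid (L : AffineConnection M) (f : d ⟶ c) (hp : M.IsPath n p x y)
    (hq : M.IsPath m q x z) {i j : ℕ} (hi : i ≤ m) (hj : j ≤ n) : M.res f (grid L.op p q i j) =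
      grid L.op (fun i => M.res f (p i)) (fun i => M.res f (q i)) i j := by
  induction i generalizing j with
  | zero => rfl
  | succ i ih =>
    rw [grid, res_gridStep f _ fun k hk => (hp.grid_row L hq (by omega)).2.2 k (by omega)]
    · exact gridStep_congr fun k hk => ih (by omega) (by omega)
    · rw [grid_apply_zero _ (hp.1.trans hq.1.symm)]
      exact hq.2.2 i hi

/-- Row by row: the rows at height `i` are paths with the same ends, so they transport `q (i + 1)`
to the same point. -/
theorem AffineConnection.IsFlat.grid_eq (hM : IsManifold R M) (hflat : L.IsFlat)
    (hp : M.IsPath n p x y) (hp' : M.IsPath n' p' x y) (hq : M.IsPath m q x z) {i : ℕ}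
    (hi : i ≤ m) : grid L.op p q i n = grid L.op p' q i n' := by
  induction i with
  | zero => exact hp.2.1.trans hp'.2.1.symm
  | succ i ih =>
    have h := hp.grid_row L hq (i := i) (by omega)
    have h' := hp'.grid_row L hq (i := i) (by omega)
    rw [← ih (by omega)] at h'
    exact hflat.gridStep_eq hM h h' (hq.2.2 i hi)

theorem AffineConnection.IsSymmetric.grid_transpose (hsymm : L.IsSymmetric)
    (hp : M.IsPath n p x y) (hq : M.IsPath m q x z) {i j : ℕ} (hi : i ≤ m) (hj : j ≤ n) :
    grid L.op p q i j = grid L.op q p j i := by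
  have h0 := hp.1.trans hq.1.symm
  induction i generalizing j with
  | zero => rw [grid_apply_zero _ h0.symm]; rfl
  | succ i ih =>
    induction j with
    | zero => exact grid_apply_zero _ h0 _
    | succ j ihj =>
      change L.op (grid L.op p q (i + 1) j) (grid L.op p q i j) (grid L.op p q i (j + 1)) =
        L.op (grid L.op q p (j + 1) i) (grid L.op q p j i) (grid L.op q p j (i + 1))
      rw [hsymm _ _ _ ((hp.grid_row L hq (by omega)).2.2 j (by omega))
        (hp.near_grid_succ L hq (by omega) (by omega)), ih (by omega) (by omega),
        ih (by omega) (by omega), ihj (by omega)]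

/-- Change one path, transpose, change the other, transpose back. -/
theorem AffineConnection.IsFlat.grid_eq_grid (hM : IsManifold R M) (hflat : L.IsFlat)
    (hsymm : L.IsSymmetric) (hp : M.IsPath n p x y) (hp' : M.IsPath n' p' x y)
    (hq : M.IsPath m q x z) (hq' : M.IsPath m' q' x z) :
    grid L.op p q m n = grid L.op p' q' m' n' := by
  rw [hflat.grid_eq hM hp hp' hq le_rfl, hsymm.grid_transpose hp' hq le_rfl le_rfl,
    hflat.grid_eq hM hq hq' hp' le_rfl, hsymm.grid_transpose hq' hp' le_rfl le_rfl]

/-- The path `p` of length `n`, followed by the path `q`. -/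
def pathAppend {α : Type*} (n : ℕ) (p q : ℕ → α) (i : ℕ) : α := if i < n then p i else q (i - n)

theorem pathAppend_add {α : Type*} (n : ℕ) (p q : ℕ → α) (i : ℕ) :
    pathAppend n p q (n + i) = q i := by simp [pathAppend]

theorem pathAppend_of_le {α : Type*} {n : ℕ} {p q : ℕ → α} (h : p n = q 0) {i : ℕ} (hi : i ≤ n) :
    pathAppend n p q i = p i := by
  rcases hi.lt_or_eq with hi | rfl
  · exact if_pos hi
  · simp [pathAppend, h]

theorem NeighbourSpace.IsPath.append (hp : M.IsPath n p x y) (hq : M.IsPath m q y z) :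
    M.IsPath (n + m) (pathAppend n p q) x z := by
  have h := hp.2.1.trans hq.1.symm
  refine ⟨(pathAppend_of_le h (Nat.zero_le _)).trans hp.1, by rw [pathAppend_add, hq.2.1], ?_⟩
  intro i hi
  rcases lt_or_ge i n with hin | hin
  · rw [pathAppend_of_le h hin.le, pathAppend_of_le h hin]
    exact hp.2.2 i hin
  · obtain ⟨i, rfl⟩ := Nat.exists_eq_add_of_le hin
    rw [add_assoc, pathAppend_add, pathAppend_add]
    exact hq.2.2 i (by omega)

theorem gridStep_pathAppend {α : Type*} {op : α → α → α → α} {p : ℕ → α} {a : α} {n : ℕ} (j : ℕ) :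
    gridStep op p a (n + j) = gridStep op (fun j => p (n + j)) (gridStep op p a n) j := by
  induction j with
  | zero => rfl
  | succ j ih => rw [← add_assoc, gridStep, ih, gridStep, add_assoc]

/-- The grid over a concatenation consists of two grids glued along a column: the last column of the
first is the vertical path of the second. -/
theorem grid_pathAppend {α : Type*} {op : α → α → α → α} {p q p' : ℕ → α} (h : p n = p' 0) (i : ℕ) :
    (∀ j ≤ n, grid op (pathAppend n p p') q i j = grid op p q i j) ∧
      ∀ j, grid op (pathAppend n p p') q i (n + j) = grid op p' (fun i => grid op p q i n) i j := by
  induction i with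
  | zero => exact ⟨fun j hj => pathAppend_of_le h hj, fun j => pathAppend_add _ _ _ _⟩
  | succ i ih =>
    have h1 : ∀ j ≤ n, grid op (pathAppend n p p') q (i + 1) j = grid op p q (i + 1) j :=
      fun j hj => gridStep_congr fun k hk => ih.1 k (by omega)
    refine ⟨h1, fun j => ?_⟩
    change gridStep _ _ _ _ = gridStep _ _ _ _
    rw [gridStep_pathAppend]
    simp only [ih.2]
    congr 1
    exact h1 n le_rfl

end

end Grid

/-! ### The global operation and its group laws. -/

section BigOperation

variable {C : Type u} [Category.{v} C] {J : GrothendieckTopology C}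
variable {R : LineObject.{r} J} {M : NeighbourSpace.{w} J} {L : AffineConnection M}

theorem NeighbourSpace.PathConnected.exists_cover (hpc : M.PathConnected) {c : C}
    (x y z : M.Pt c) : ∃ S ∈ J c, ∀ {d : C} (f : d ⟶ c), S f →
      (∃ n p, M.IsPath n p (M.res f x) (M.res f y)) ∧
      ∃ n p, M.IsPath n p (M.res f x) (M.res f z) := by
  obtain ⟨S, hS, h⟩ := hpc c x y
  obtain ⟨T, hT, h'⟩ := hpc c x z
  exact ⟨S ⊓ T, J.intersection_covering hS hT, fun f hf => ⟨h f hf.1, h' f hf.2⟩⟩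

/-- `w` is locally the codomain of every grid spanned by paths from `x` to `y` and to `z`. -/
def AffineConnection.IsGridCodomain (L : AffineConnection M) {c : C} (z x y w : M.Pt c) : Prop :=
  ∀ {d : C} (f : d ⟶ c) (n m : ℕ) (p q : ℕ → M.Pt d), M.IsPath n p (M.res f x) (M.res f y) →
    M.IsPath m q (M.res f x) (M.res f z) → M.res f w = grid L.op p q m n

theorem AffineConnection.IsGridCodomain.unique (hpc : M.PathConnected) {c : C} {z x y w w' : M.Pt c}
    (h : L.IsGridCodomain z x y w) (h' : L.IsGridCodomain z x y w') : w = w' := by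
  obtain ⟨S, hS, hpq⟩ := hpc.exists_cover x y z
  refine M.eq_of_locally_eq hS fun f hf => ?_
  obtain ⟨⟨n, p, hp⟩, m, q, hq⟩ := hpq f hf
  rw [h f n m p q hp hq, h' f n m p q hp hq]

theorem AffineConnection.IsGridCodomain.res {c d : C} {z x y w : M.Pt c}
    (h : L.IsGridCodomain z x y w) (f : d ⟶ c) :
    L.IsGridCodomain (M.res f z) (M.res f x) (M.res f y) (M.res f w) := by
  intro e g n m p q hp hq
  rw [← M.res_comp] at hp hq ⊢
  rw [← M.res_comp] at hp hq
  exact h _ n m p q hp hq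

/-- Paths exist only on a cover and are chosen there arbitrarily; independence of the paths makes
the codomains a compatible family, which glues. -/
theorem AffineConnection.exists_isGridCodomain (hM : IsManifold R M) (hpc : M.PathConnected)
    (hsymm : L.IsSymmetric) (hflat : L.IsFlat) {c : C} (z x y : M.Pt c) :
    ∃ w, L.IsGridCodomain z x y w := by
  obtain ⟨S, hS, hpq⟩ := hpc.exists_cover x y z
  choose hp hq using @hpq
  choose n p hp using @hp
  choose m q hq using @hq
  have hsheaf := ((isSheaf_iff_isSheaf_of_type _ _).1 M.sheaf.property) S hS
  obtain ⟨w, hw, -⟩ := hsheaf (fun d f hf => grid L.op (p f hf) (q f hf) (m f hf) (n f hf)) (by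
    refine (Presieve.compatible_iff_sieveCompatible _).2 ?_
    intro d e f g hf
    change _ = M.res g _
    rw [L.res_grid g (hp f hf) (hq f hf) le_rfl le_rfl]
    have hp' := hp (g ≫ f) (S.downward_closed hf g)
    have hq' := hq (g ≫ f) (S.downward_closed hf g)
    simp only [M.res_comp] at hp' hq'
    exact hflat.grid_eq_grid hM hsymm hp' ((hp f hf).res g) hq' ((hq f hf).res g))
  refine ⟨w, fun {d} f k l a b ha hb => ?_⟩
  -- To compare with given paths at stage `d`, pull the cover back along `f` and use independence of
  -- the paths there.
  refine M.eq_of_locally_eq (J.pullback_stable f hS) fun {e} g hg => ?_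
  have hw' : M.res (g ≫ f) w = _ := hw (g ≫ f) hg
  have hp' := hp (g ≫ f) hg
  have hq' := hq (g ≫ f) hg
  simp only [M.res_comp] at hp' hq'
  rw [← M.res_comp, hw', L.res_grid g ha hb le_rfl le_rfl]
  exact hflat.grid_eq_grid hM hsymm hp' (ha.res g) hq' (hb.res g)

namespace TernaryOp

theorem ext_op {B B' : TernaryOp M} (h : ∀ {c : C} (z x y : M.Pt c), B.op z x y = B'.op z x y) :
    B = B' := by
  cases B
  cases B'
  congr
  funext c z x y
  exact h z x y

variable {B : TernaryOp M}

theorem IsExtensionOf.isGridCodomain (hB : B.IsExtensionOf L) {c : C} (z x y : M.Pt c) :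
    L.IsGridCodomain z x y (B.op z x y) := fun f n m p q hp hq => by
  rw [B.op_res]
  exact hB _ _ _ n m p q hp hq

theorem IsExtensionOf.unique (hpc : M.PathConnected) {B' : TernaryOp M} (hB : B.IsExtensionOf L)
    (hB' : B'.IsExtensionOf L) : B' = B :=
  ext_op fun z x y => AffineConnection.IsGridCodomain.unique hpc (hB'.isGridCodomain z x y)
    (hB.isGridCodomain z x y)

theorem exists_isExtensionOf (hM : IsManifold R M) (hpc : M.PathConnected)
    (hsymm : L.IsSymmetric) (hflat : L.IsFlat) : ∃ B : TernaryOp M, B.IsExtensionOf L := by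
  choose op hop using fun {c : C} (z x y : M.Pt c) =>
    L.exists_isGridCodomain hM hpc hsymm hflat z x y
  refine ⟨⟨fun z x y => op z x y, fun f z x y => AffineConnection.IsGridCodomain.unique hpc
    (AffineConnection.IsGridCodomain.res (hop z x y) f) (hop _ _ _)⟩, ?_⟩
  intro c x y z n m p q hp hq
  have := hop z x y (𝟙 c) n m p q
  simp only [M.res_id] at this
  exact this hp hq

theorem IsExtensionOf.op_eq (hB : B.IsExtensionOf L) {c : C} {z x y : M.Pt c} (hy : M.near x y)
    (hz : M.near x z) : B.op z x y = L.op z x y := by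
  have path : ∀ t, M.near x t → M.IsPath 1 (fun i => if i = 0 then x else t) x t := fun t ht =>
    ⟨rfl, rfl, fun i hi => by simpa [Nat.lt_one_iff.1 hi] using ht⟩
  rw [hB x y z 1 1 _ _ (path y hy) (path z hz)]
  rfl

theorem IsExtensionOf.op_self (hpc : M.PathConnected) (hB : B.IsExtensionOf L) {c : C}
    (z x : M.Pt c) : B.op z x x = z := by
  obtain ⟨S, hS, h⟩ := hpc c x z
  refine M.eq_of_locally_eq hS fun f hf => ?_
  obtain ⟨m, q, hq⟩ := h f hf
  rw [B.op_res, hB _ _ _ 0 m (fun _ => M.res f x) q ⟨rfl, rfl, by simp⟩ hq,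
    grid_apply_zero _ hq.1.symm, hq.2.1]

theorem IsExtensionOf.op_symm (hpc : M.PathConnected) (hsymm : L.IsSymmetric)
    (hB : B.IsExtensionOf L) {c : C} (z x y : M.Pt c) : B.op z x y = B.op y x z := by
  obtain ⟨S, hS, h⟩ := hpc.exists_cover x y z
  refine M.eq_of_locally_eq hS fun f hf => ?_
  obtain ⟨⟨n, p, hp⟩, m, q, hq⟩ := h f hf
  rw [B.op_res, B.op_res, hB _ _ _ n m p q hp hq, hB _ _ _ m n q p hq hp,
    hsymm.grid_transpose hp hq le_rfl le_rfl]

/-- The right column of the first grid is a path from `y` to [zxy], so the second grid can be pasted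
to it along this column. -/
theorem IsExtensionOf.op_op (hpc : M.PathConnected) (hB : B.IsExtensionOf L) {c : C}
    (z x y w : M.Pt c) : B.op (B.op z x y) y w = B.op z x w := by
  obtain ⟨S, hS, h⟩ := hpc.exists_cover x y z
  obtain ⟨T, hT, h'⟩ := hpc c y w
  refine M.eq_of_locally_eq (J.intersection_covering hS hT) fun f hf => ?_
  obtain ⟨⟨n, p, hp⟩, m, q, hq⟩ := h f hf.1
  obtain ⟨n', p', hp'⟩ := h' f hf.2
  have hcol := hp.grid_col L hq le_rfl
  rw [hp.2.1] at hcol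
  rw [B.op_res, B.op_res, B.op_res, hB _ _ _ n m p q hp hq, hB _ _ _ n' m p' _ hp' hcol,
    hB _ _ _ _ m _ q (hp.append hp') hq]
  exact ((grid_pathAppend (hp.2.1.trans hp'.1.symm) m).2 n').symm

theorem IsExtensionOf.op_op_right (hpc : M.PathConnected) (hsymm : L.IsSymmetric)
    (hB : B.IsExtensionOf L) {c : C} (z x y w : M.Pt c) : B.op w y (B.op z x y) = B.op w x z := by
  rw [hB.op_symm hpc hsymm w, hB.op_op hpc, hB.op_symm hpc hsymm]

/-- [xo[yoz]] = [[xoy]y[yoz]] = [[xoy]y[zoy]] = [[xoy]oz]. -/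
theorem IsExtensionOf.op_assoc (hpc : M.PathConnected) (hsymm : L.IsSymmetric)
    (hB : B.IsExtensionOf L) {c : C} (o x y z : M.Pt c) :
    B.op (B.op x o y) o z = B.op x o (B.op y o z) := by
  rw [← hB.op_op hpc x o y (B.op y o z), hB.op_symm hpc hsymm y o z,
    hB.op_op_right hpc hsymm]

theorem IsExtensionOf.isAbelianGroup (hpc : M.PathConnected) (hsymm : L.IsSymmetric)
    (hB : B.IsExtensionOf L) {c : C} (o : M.Pt c) :
    IsAbelianGroup (fun x y => B.op x o y) o :=
  letI : Zero (M.Pt c) := ⟨o⟩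
  letI : Add (M.Pt c) := ⟨fun x y => B.op x o y⟩
  -- The inverse is [oxo], since [[oxo]ox] = [oxx] = o.
  letI : Neg (M.Pt c) := ⟨fun x => B.op o x o⟩
  ⟨{ nsmul := nsmulRec
     zsmul := zsmulRec
     add_assoc := fun x y z => hB.op_assoc hpc hsymm o x y z
     zero_add := fun x => (hB.op_symm hpc hsymm o o x).trans (hB.op_self hpc x o)
     add_zero := fun x => hB.op_self hpc x o
     add_comm := fun x y => hB.op_symm hpc hsymm x o y
     neg_add_cancel := fun x => (hB.op_op hpc o x o x).trans (hB.op_self hpc o x) },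
   fun _ _ => rfl, rfl⟩

theorem IsExtensionOf.bijective (hpc : M.PathConnected) (hB : B.IsExtensionOf L) {c : C}
    (o o' : M.Pt c) : Function.Bijective fun z => B.op z o o' :=
  Function.bijective_iff_has_inverse.2 ⟨fun z => B.op z o' o,
    fun z => (hB.op_op hpc z o o' o).trans (hB.op_self hpc z o),
    fun z => (hB.op_op hpc z o' o o').trans (hB.op_self hpc z o')⟩

/-- The map is translation by o' in the group at `o`, and both sides equal x +_o y +_o o'. -/
theorem IsExtensionOf.map_add (hpc : M.PathConnected) (hsymm : L.IsSymmetric)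
    (hB : B.IsExtensionOf L) {c : C} (o o' x y : M.Pt c) :
    B.op (B.op x o y) o o' = B.op (B.op x o o') o' (B.op y o o') := by
  rw [hB.op_op_right hpc hsymm, hB.op_assoc hpc hsymm, hB.op_assoc hpc hsymm,
    hB.op_symm hpc hsymm y]

end TernaryOp

end BigOperation

end Synthetic

theorem theorem3p6 {C : Type u} [Category.{v} C] {J : GrothendieckTopology C}
    (R : Synthetic.LineObject.{r} J) (M : Synthetic.NeighbourSpace.{w} J)
    (hM : Synthetic.IsManifold R M) (hpc : M.PathConnected)
    (L : Synthetic.AffineConnection M) (hsymm : L.IsSymmetric) (hflat : L.IsFlat) :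
    ∃ B : Synthetic.TernaryOp M,
      -- `B` is the extended operation `[zxy]`: it is given by grids, it is the only operation
      -- given by grids, and it extends the connection
      B.IsExtensionOf L ∧
      (∀ B' : Synthetic.TernaryOp M, B'.IsExtensionOf L → B' = B) ∧
      (∀ {c : C} (z x y : M.Pt c), M.near x y → M.near x z → B.op z x y = L.op z x y) ∧
      -- for each `o`, the operation `x +_o y = [xoy]` is an abelian group with unit `o`
      (∀ (c : C) (o : M.Pt c), Synthetic.IsAbelianGroup (fun x y => B.op x o y) o) ∧
      -- for all `o`, `o'`, the map `z ↦ [zoo']` is an isomorphism from `+_o` to `+_{o'}`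
      (∀ (c : C) (o o' : M.Pt c),
        Function.Bijective (fun z : M.Pt c => B.op z o o') ∧
        ∀ x y : M.Pt c, B.op (B.op x o y) o o' = B.op (B.op x o o') o' (B.op y o o')) := by
  obtain ⟨B, hB⟩ := Synthetic.TernaryOp.exists_isExtensionOf hM hpc hsymm hflat
  exact ⟨B, hB, fun _ hB' => hB.unique hpc hB', fun _ _ _ hy hz => hB.op_eq hy hz,
    fun _ o => hB.isAbelianGroup hpc hsymm o,
    fun _ o o' => ⟨hB.bijective hpc o o', hB.map_add hpc hsymm o o'⟩⟩
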